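/- Let $N>1$ and let $\mathcal G=\bigcup_{i=1}^N J_i\subset\mathbb R^N$, $J_i=\mathbb R_+e_i$, be the junction with $N$ edges ($(e_i)$ the canonical basis), with geodesic distance $d(x,y)=|x-y|$ if $x,y$ lie on a common edge and $d(x,y)=|x|+|y|$ otherwise. Let $T>0$, $p>1$. \textbf{Costs.} Let $g_*\in\mathbb R$ and $g_i\in C_b(\mathbb R_+)$, and set $g(y)=g_i(|y|)$ for $y\in J_i\setminus\{0\}$ and $g(0)=\min\{g_*,\min_i g_i(0)\}$. Let $\ell_*\in C([0,T])$ and $\ell_i\in C(\mathbb R_+\times\mathbb R\times[0,T])$, $i=1,\dots,N$, be real-valued, such that $\ell_i(\cdot,\cdot,s)$ is differentiable on $\mathbb R_+\times\mathbb R$ for every $s\in[0,T]$ and $\partial_y\ell_i,\partial_a\ell_i$ are continuous in $(y,a,s)$ (one-sided derivative in $y$ at $y=0$). Assume, for all $i$: [H1] there are $C_0>0$ and $c_0\in\mathbb R$ with $\ell_i(y,a,s)\ge C_0|a|^p+c_0$ and $\ell_*(s)\ge c_0$ for all $(y,a,s)\in\mathbb R_+\times\mathbb R\times[0,T]$; [H2]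 for every $r>0$ there is a modulus of continuity $\omega_r$ with $|\ell_i(y,a,t_1)-\ell_i(y,a,t_2)|\le(1+|a|^p)\,\omega_r(|t_1-t_2|)$ for $y\in[0,r]$, $a\in\mathbb R$, $t_1,t_2\in[0,T]$; [H3] for every $r>0$ there is $\tilde c(r)\ge0$ with $|\partial_y\ell_i(y,a,s)|\le\tilde c(r)(|a|^p+1)$ and $|\partial_a\ell_i(y,a,s)|\le\tilde c(r)(|a|^{p-1}+1)$ for $(y,a,s)\in[0,r]\times\mathbb R\times[0,T]$; [H4] $a\mapsto\ell_i(y,a,s)$ is strictly convex for every $(y,s)\in\mathbb R_+\times[0,T]$; [H5] $g_i\in C^1(\mathbb R_+)$. \textbf{Value function.} For $x\in\mathcal G$, $t\in[0,T]$ let $\Gamma_t[x]$ be the set of $y\in C([t,T];\mathcal G)\cap W^{1,p}(t,T;\mathbb R^N)$ with $y(t)=x$. Set $\ell_0(s)=\min\{\ell_*(s),\min_i\ell_i(0,0,s)\}$; for $y\in\Gamma_t[x]$ let $L(y(s),y'(s),s)=\ell_i(|y(s)|,\bar\alpha(s),s)$ if $y(s)\in J_i\setminus\{0\}$, where $y'(s)=\bar\alpha(s)e_i$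 for a.e. such $s$, and $L(y(s),y'(s),s)=\ell_0(s)$ if $y(s)=0$. Let $$J_t(x;y)=\int_t^T L(y(s),y'(s),s)\,ds+g(y(T)),\qquad u(x,t)=\inf_{y\in\Gamma_t[x]}J_t(x;y).$$ Then the running cost is integrable along every admissible trajectory, the infimum defining $u(x,t)$ is finite for every $(x,t)\in\mathcal G\times[0,T]$, and $u$ is locally Lipschitz continuous on $\mathcal G\times[0,T)$: every point of $\mathcal G\times[0,T)$ has a neighbourhood in $\mathcal G\times[0,T)$ on which $|u(x_1,t_1)-u(x_2,t_2)|\le C\,(d(x_1,x_2)+|t_1-t_2|)$ for some constant $C$. (No Lipschitz continuity of the costs $\ell_i$ in time is assumed.) If in addition $g$ is continuous on $\mathcal G$, then $u$ is locally Lipschitz continuous on $\mathcal G\times[0,T]$. -/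

import Mathlib

open MeasureTheory Set Filter Topology

noncomputable section

namespace JunctionControl

/-- The ambient Euclidean space `ℝ^N`. -/
abbrev E (N : ℕ) : Type := EuclideanSpace ℝ (Fin N)

/-- The edge `J_i = ℝ₊ e_i`, a closed half-line. -/
def edge {N : ℕ} (i : Fin N) : Set (E N) :=
  {x | ∃ r : ℝ, 0 ≤ r ∧ x = r • EuclideanSpace.single i (1 : ℝ)}

/-- The junction `𝒢`, the union of the `N` edges. -/
def junction (N : ℕ) : Set (E N) := ⋃ i : Fin N, edge i

open Classical in
/-- The geodesic distance on the junction. -/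
def geoDist {N : ℕ} (x y : E N) : ℝ :=
  if ∃ i : Fin N, x ∈ edge i ∧ y ∈ edge i then ‖x - y‖ else ‖x‖ + ‖y‖

/-- The data of the control problem: horizon `T`, exponent `p`, running costs `ℓ_i(y,a,s)`,
specific running cost `ℓ_*` at the vertex, terminal costs `g_i`, number `g_*`. -/
structure Problem (N : ℕ) where
  T : ℝ
  p : ℝ
  ell : Fin N → ℝ → ℝ → ℝ → ℝ
  ellStar : ℝ → ℝ
  g : Fin N → ℝ → ℝ
  gStar : ℝ

namespace Problem

variable {N : ℕ} (P : Problem N)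

/-- The partial derivative `∂_y ℓ_i (y,a,s)` on `y ≥ 0` (one-sided at `y = 0`). -/
def dyEll (i : Fin N) (y a s : ℝ) : ℝ := derivWithin (fun z => P.ell i z a s) (Ici 0) y

/-- The partial derivative `∂_a ℓ_i (y,a,s)`. -/
def daEll (i : Fin N) (y a s : ℝ) : ℝ := deriv (fun b => P.ell i y b s) a

/-- The domain `ℝ₊ × ℝ × [0,T]` of the running costs. -/
def dom : Set (ℝ × ℝ × ℝ) := Ici 0 ×ˢ (univ ×ˢ Icc 0 P.T)

/-- Standing assumptions on the data. -/
structure Standing : Prop where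
  T_pos : 0 < P.T
  one_lt_p : 1 < P.p
  g_cont : ∀ i, ContinuousOn (P.g i) (Ici 0)
  g_bdd : ∀ i, ∃ M : ℝ, ∀ r : ℝ, 0 ≤ r → |P.g i r| ≤ M
  ell_cont : ∀ i, ContinuousOn (fun q : ℝ × ℝ × ℝ => P.ell i q.1 q.2.1 q.2.2) P.dom
  ell_diff : ∀ i, ∀ s ∈ Icc 0 P.T,
    DifferentiableOn ℝ (fun q : ℝ × ℝ => P.ell i q.1 q.2 s) (Ici 0 ×ˢ univ)
  dyEll_cont : ∀ i, ContinuousOn (fun q : ℝ × ℝ × ℝ => P.dyEll i q.1 q.2.1 q.2.2) P.dom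
  daEll_cont : ∀ i, ContinuousOn (fun q : ℝ × ℝ × ℝ => P.daEll i q.1 q.2.1 q.2.2) P.dom
  ellStar_cont : ContinuousOn P.ellStar (Icc 0 P.T)

/-- [H1]: coercivity of the running costs. -/
def H1 : Prop :=
  ∃ C₀ c₀ : ℝ, 0 < C₀ ∧
    (∀ i, ∀ y : ℝ, 0 ≤ y → ∀ a : ℝ, ∀ s ∈ Icc 0 P.T, C₀ * |a| ^ P.p + c₀ ≤ P.ell i y a s) ∧
    ∀ s ∈ Icc 0 P.T, c₀ ≤ P.ellStar s

/-- [H2]: modulus of continuity in time. -/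
def H2 : Prop :=
  ∀ r : ℝ, 0 < r → ∃ ω : ℝ → ℝ, Tendsto ω (𝓝[≥] 0) (𝓝 0) ∧
    ∀ i, ∀ y ∈ Icc 0 r, ∀ a : ℝ, ∀ t₁ ∈ Icc 0 P.T, ∀ t₂ ∈ Icc 0 P.T,
      |P.ell i y a t₁ - P.ell i y a t₂| ≤ (1 + |a| ^ P.p) * ω |t₁ - t₂|

/-- [H3]: growth of the partial derivatives of the running costs. -/
def H3 : Prop :=
  ∀ r : ℝ, 0 < r → ∃ c : ℝ, 0 ≤ c ∧
    ∀ i, ∀ y ∈ Icc 0 r, ∀ a : ℝ, ∀ s ∈ Icc 0 P.T,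
      |P.dyEll i y a s| ≤ c * (|a| ^ P.p + 1) ∧
      |P.daEll i y a s| ≤ c * (|a| ^ (P.p - 1) + 1)

/-- [H4]: strict convexity in the velocity. -/
def H4 : Prop :=
  ∀ i, ∀ y : ℝ, 0 ≤ y → ∀ s ∈ Icc 0 P.T, StrictConvexOn ℝ univ (fun a => P.ell i y a s)

/-- [H5]: the terminal costs are `C¹` on `ℝ₊`. -/
def H5 : Prop := ∀ i, ContDiffOn ℝ 1 (P.g i) (Ici 0)

/-- The cost `ℓ_0` for staying at the vertex. -/
def ellZero (s : ℝ) : ℝ := min (P.ellStar s) (⨅ i : Fin N, P.ell i 0 0 s)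

/-- The running cost `L(y, α, s)`. If `y` is in the interior of the edge `J_i`, the scalar velocity
`ᾱ` of the velocity vector `α = ᾱ e_i` is its `i`-th coordinate. -/
def runningCost (y α : E N) (s : ℝ) : ℝ :=
  (∑ i : Fin N, (edge i \ {0}).indicator (fun z : E N => P.ell i ‖z‖ (α i) s) y)
    + ({0} : Set (E N)).indicator (fun _ => P.ellZero s) y

/-- The terminal cost `g` on the junction. -/
def terminalCost (y : E N) : ℝ :=
  (∑ i : Fin N, (edge i \ {0}).indicator (fun z : E N => P.g i ‖z‖) y)
    + ({0} : Set (E N)).indicator (fun _ => min P.gStar (⨅ i : Fin N, P.g i 0)) y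

/-- `y ∈ Γ_t[x]`: `y` takes its values in the junction on `[t,T]`, starts from `x` at time `t`, and
belongs to `C([t,T]) ∩ W^{1,p}(t,T; ℝ^N)`, that is, `y` is absolutely continuous on `[t,T]` with
derivative in `L^p(t,T)`; the a.e. derivative `deriv y` is then the weak derivative. Only the values
of `y` on `[t,T]` are relevant. -/
structure Admissible (t : ℝ) (x : E N) (y : ℝ → E N) : Prop where
  mem : ∀ s ∈ Icc t P.T, y s ∈ junction N
  start : y t = x
  absCont : AbsolutelyContinuousOnInterval y t P.T
  deriv_memLp : MemLp (deriv y) (ENNReal.ofReal P.p) (volume.restrict (Ioo t P.T))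

/-- The cost `J_t(x; y)` of a trajectory. -/
def cost (t : ℝ) (y : ℝ → E N) : ℝ :=
  (∫ s in t..P.T, P.runningCost (y s) (deriv y s) s) + P.terminalCost (y P.T)

/-- The value function `u(x,t) = inf_{y ∈ Γ_t[x]} J_t(x; y)`. -/
def value (x : E N) (t : ℝ) : ℝ := sInf (P.cost t '' {y | P.Admissible t x y})

end Problem

/-- `f` is locally Lipschitz continuous on `𝒢 × S`: each point has a neighbourhood in `𝒢 × S` on
which `f` is Lipschitz continuous, for the geodesic distance on the junction. -/
def LocLip {N : ℕ} (f : E N → ℝ → ℝ) (S : Set ℝ) : Prop :=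
  ∀ x ∈ junction N, ∀ t ∈ S, ∃ C δ : ℝ, 0 < δ ∧
    ∀ x₁ ∈ junction N, ∀ x₂ ∈ junction N, ∀ t₁ ∈ S, ∀ t₂ ∈ S,
      geoDist x x₁ < δ → geoDist x x₂ < δ → |t - t₁| < δ → |t - t₂| < δ →
        |f x₁ t₁ - f x₂ t₂| ≤ C * (geoDist x₁ x₂ + |t₁ - t₂|)

end JunctionControl

end

/-! Trajectories are only ever compared at equal times: the clock is never rescaled, so the running
costs are never compared at two different times. Coercivity confines near-optimal trajectories
starting in a ball to a larger ball and bounds their energy `∫ ‖y'‖^p` (`exists_near_bounded`).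

To move the starting point by `D`, a near-optimal trajectory `y` is displaced along its edge by a
gap `w` with `w(t) = D`. The gap closes at unit speed while `‖y'‖ ≤ M` and is frozen at faster times
(`exists_lipschitz_decay`). While it is frozen, velocities agree and the costs differ by at most `D
* K * (‖y'‖^p + 1)`, whose integral is controlled by the energy. While it closes, both speeds are at
most `M + 1`, the cost difference is bounded, and this phase lasts at most `D`. The total loss is
`O(D)`.

Inward (`value_shrink_le_cost`), the displaced curve sits at the vertex while `y` is closer to the
vertex than the gap. If `y` is slow, the gap is closing and this pays; if `y` is fast, `M` is so
large that `y` spends more than the curve at rest. A gap left at the final time is absorbed by the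
terminal cost, which at the vertex is at most every `g_i(0)`.

Outward (`exists_expand`), the displacement is used only until `y` reaches the vertex. A remaining
gap is then travelled at unit speed (`exists_value_pt_le_zero`), because the value at the vertex
grows at most linearly in time (`exists_value_zero_le`), itself a consequence of the inward bound.
Time must be left for this: a long-lived gap means a long fast phase, which the energy bound
excludes for large `M` when `t ≤ T - η`. If the terminal cost is continuous, no remaining time is
needed and `η = 0` is allowed.

In time, waiting gives one inequality. For the other (`exists_value_le_of_le`), spatial growth at
slope `Λ` costs at most `Λ ∫ ‖y'‖`, and Young's inequality absorbs it into the coercive running cost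
up to a multiple of the elapsed time. -/

noncomputable section

/-! ### Absolutely continuous functions -/

namespace AbsolutelyContinuousOnInterval

variable {X Y Z : Type*} [PseudoMetricSpace X] [PseudoMetricSpace Y] [PseudoMetricSpace Z]

theorem of_dist_le {f : ℝ → X} {g : ℝ → Y} {h : ℝ → Z} {a b C : ℝ}
    (hg : AbsolutelyContinuousOnInterval g a b) (hh : AbsolutelyContinuousOnInterval h a b)
    (H : ∀ s r, dist (f s) (f r) ≤ C * (dist (g s) (g r) + dist (h s) (h r))) :
    AbsolutelyContinuousOnInterval f a b := by
  have h0 := (Tendsto.add hg hh).const_mul C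
  refine squeeze_zero (fun E => Finset.sum_nonneg fun i _ => dist_nonneg) (fun E => ?_)
    (by simpa using h0)
  rw [← Finset.sum_add_distrib, Finset.mul_sum]
  exact Finset.sum_le_sum fun i _ => H _ _

theorem congr {f g : ℝ → X} {a b : ℝ} (hf : AbsolutelyContinuousOnInterval f a b)
    (h : ∀ s ∈ uIcc a b, f s = g s) : AbsolutelyContinuousOnInterval g a b := by
  rw [absolutelyContinuousOnInterval_iff] at hf ⊢
  intro ε hε
  obtain ⟨δ, hδ, H⟩ := hf ε hε
  refine ⟨δ, hδ, fun E hE hE' => ?_⟩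
  rw [Finset.sum_congr rfl fun i hi => by rw [← h _ (hE.1 i hi).1, ← h _ (hE.1 i hi).2]]
  exact H E hE hE'

/-- Composition with a nonexpansive monotone change of parameter. -/
theorem comp_monotone {f : ℝ → X} {φ : ℝ → ℝ} {a b c d : ℝ}
    (hf : AbsolutelyContinuousOnInterval f c d) (hφ : Monotone φ)
    (hφ1 : ∀ s r, dist (φ s) (φ r) ≤ dist s r)
    (hmap : ∀ s ∈ uIcc a b, φ s ∈ uIcc c d) :
    AbsolutelyContinuousOnInterval (f ∘ φ) a b := by
  rw [absolutelyContinuousOnInterval_iff] at hf ⊢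
  intro ε hε
  obtain ⟨δ, hδ, H⟩ := hf ε hε
  refine ⟨δ, hδ, fun E hE hE' => ?_⟩
  refine H (E.1, fun i => (φ (E.2 i).1, φ (E.2 i).2)) ⟨fun i hi => ?_, ?_⟩ ?_
  · exact ⟨hmap _ (hE.1 i hi).1, hmap _ (hE.1 i hi).2⟩
  · intro i hi j hj hij
    have hdis := hE.2 hi hj hij
    simp only [Function.onFun, uIoc, Set.disjoint_left, Set.mem_Ioc] at hdis ⊢
    rintro x ⟨hx1, hx2⟩ ⟨hx3, hx4⟩
    rw [← hφ.map_min] at hx1 hx3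
    rw [← hφ.map_max] at hx2 hx4
    -- If the image intervals met, monotonicity would give `m < M`, and `M` would then lie in both
    -- original intervals.
    set m := max (min (E.2 i).1 (E.2 i).2) (min (E.2 j).1 (E.2 j).2) with hm
    set M := min (max (E.2 i).1 (E.2 i).2) (max (E.2 j).1 (E.2 j).2) with hM
    have hlt : φ m < φ M := by
      rw [hm, hM, hφ.map_max (a := min _ _), hφ.map_min (a := max _ _)]
      exact lt_of_lt_of_le (max_lt hx1 hx3) (le_min hx2 hx4)
    have hmM : m < M := hφ.reflect_lt hlt
    exact hdis (a := M)
      ⟨lt_of_le_of_lt (le_max_left _ _) hmM, min_le_left _ _⟩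
      ⟨lt_of_le_of_lt (le_max_right _ _) hmM, min_le_right _ _⟩
  · exact lt_of_le_of_lt (Finset.sum_le_sum fun i _ => hφ1 _ _) hE'

/-- Stopping `f` at `b` and starting `g` at `b` are compositions with the nonexpansive maps `min ·
b` and `max · b`. Increments of the glued curve are dominated by the sum of theirs, even across `b`,
since the values match there. -/
theorem concat {F : Type*} [SeminormedAddCommGroup F] {f g : ℝ → F} {a b c : ℝ} (hab : a ≤ b)
    (hbc : b ≤ c) (hf : AbsolutelyContinuousOnInterval f a b)
    (hg : AbsolutelyContinuousOnInterval g b c) (h : f b = g b) :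
    AbsolutelyContinuousOnInterval (fun s => if s ≤ b then f s else g s) a c := by
  have h1 : AbsolutelyContinuousOnInterval (f ∘ fun s => min s b) a c := by
    refine hf.comp_monotone (fun x y hxy => min_le_min_right b hxy) (fun s r => ?_) ?_
    · rw [Real.dist_eq, Real.dist_eq]
      have := abs_min_sub_min_le_max s b r b
      simpa using this
    · intro s hs
      rw [uIcc_of_le (hab.trans hbc)] at hs
      rw [uIcc_of_le hab]
      exact ⟨le_min hs.1 hab, min_le_right _ _⟩
  have h2 : AbsolutelyContinuousOnInterval (g ∘ fun s => max s b) a c := by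
    refine hg.comp_monotone (fun x y hxy => max_le_max_right b hxy) (fun s r => ?_) ?_
    · rw [Real.dist_eq, Real.dist_eq]
      have := abs_max_sub_max_le_max s b r b
      simpa using this
    · intro s hs
      rw [uIcc_of_le (hab.trans hbc)] at hs
      rw [uIcc_of_le hbc]
      exact ⟨le_max_right _ _, max_le hs.2 hbc⟩
  refine of_dist_le (C := 1) h1 h2 fun s r => ?_
  simp only [Function.comp, one_mul]
  rcases le_or_gt s b with hs | hs <;> rcases le_or_gt r b with hr | hr
  · simp [hs, hr]
  · simp only [hs, if_true, not_le.2 hr, if_false, min_eq_left hs, min_eq_right hr.le,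
      max_eq_right hs, max_eq_left hr.le]
    calc dist (f s) (g r) ≤ dist (f s) (f b) + dist (f b) (g r) := dist_triangle _ _ _
      _ = _ := by rw [h]
  · simp only [hr, if_true, not_le.2 hs, if_false, min_eq_left hr, min_eq_right hs.le,
      max_eq_right hr, max_eq_left hs.le]
    calc dist (g s) (f r) ≤ dist (g s) (g b) + dist (g b) (f r) := dist_triangle _ _ _
      _ = _ := by rw [h]; ring
  · simp [not_le.2 hs, not_le.2 hr, max_eq_left hs.le, max_eq_left hr.le]

end AbsolutelyContinuousOnInterval

/-! ### Integral comparison, the decaying gap, and power inequalities -/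

theorem intervalIntegral_mono_of_ae_Ioo {f g : ℝ → ℝ} {a b : ℝ} (hab : a ≤ b)
    (hf : IntervalIntegrable f volume a b) (hg : IntervalIntegrable g volume a b)
    (h : ∀ᵐ s, s ∈ Ioo a b → f s ≤ g s) :
    ∫ s in a..b, f s ≤ ∫ s in a..b, g s := by
  rw [intervalIntegral.integral_of_le hab, intervalIntegral.integral_of_le hab,
    integral_Ioc_eq_integral_Ioo, integral_Ioc_eq_integral_Ioo]
  rw [intervalIntegrable_iff_integrableOn_Ioo_of_le hab] at hf hg
  exact setIntegral_mono_on_ae hf hg measurableSet_Ioo h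

/-- A nonnegative function that starts from `D` and decreases at unit speed on `B` until it
vanishes, and is constant off `B`. -/
theorem exists_lipschitz_decay {B : Set ℝ} (hB : MeasurableSet B) (t : ℝ) {D : ℝ} (hD : 0 ≤ D) :
    ∃ w : ℝ → ℝ, LipschitzWith 1 w ∧ w t = D ∧ (∀ s, 0 ≤ w s) ∧ (∀ s, t ≤ s → w s ≤ D) ∧
      (∀ s, t ≤ s → 0 < w s → D - w s = ∫ σ in t..s, B.indicator 1 σ) ∧
      ∀ᵐ s, (0 < w s → HasDerivAt w (-B.indicator 1 s) s) ∧ (w s = 0 → HasDerivAt w 0 s) := by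
  set b : ℝ → ℝ := B.indicator 1 with hb
  have hb0 : ∀ s, 0 ≤ b s := fun s => indicator_nonneg (fun _ _ => zero_le_one) s
  have hb1 : ∀ s, b s ≤ 1 := fun s => indicator_le_self' (fun _ _ => zero_le_one) s
  have hbm : Measurable b := measurable_one.indicator hB
  have hbl : LocallyIntegrable b volume := by
    refine (locallyIntegrable_const (1 : ℝ)).mono hbm.aestronglyMeasurable
      (Eventually.of_forall fun s => ?_)
    simpa [abs_of_nonneg (hb0 s)] using hb1 s
  have hbi : ∀ x y : ℝ, IntervalIntegrable b volume x y := fun x y =>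
    (LocallyIntegrable.integrableOn_isCompact hbl isCompact_uIcc).intervalIntegrable
  set W : ℝ → ℝ := fun s => D - ∫ σ in t..s, b σ with hW
  have hWsub : ∀ x y, W x - W y = ∫ σ in x..y, b σ := by
    intro x y
    simp only [hW]
    rw [← intervalIntegral.integral_interval_sub_left (hbi t y) (hbi t x)]
    ring
  have hWlip : LipschitzWith 1 W := by
    refine LipschitzWith.of_dist_le_mul fun x y => ?_
    rw [Real.dist_eq, hWsub, NNReal.coe_one, Real.dist_eq, abs_sub_comm]
    refine intervalIntegral.norm_integral_le_of_norm_le_const (C := 1) (f := b) fun s _ => ?_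
    simpa [abs_of_nonneg (hb0 s)] using hb1 s
  have hlip : LipschitzWith 1 fun s => max (W s) 0 := hWlip.max_const 0
  refine ⟨fun s => max (W s) 0, hlip, by simp [hW, hD], fun s => le_max_right _ _, fun s hs => ?_,
    fun s hs h => ?_, ?_⟩
  · refine max_le ?_ hD
    have := intervalIntegral.integral_nonneg (μ := volume) hs fun u _ => hb0 u
    simp only [hW]; linarith
  · have h' : 0 < W s := by simpa using h
    show D - max (W s) 0 = _
    rw [max_eq_left h'.le]; simp [hW]
  -- Where the gap is positive, Lebesgue differentiation gives its slope; where it vanishes it is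
  -- minimal, so its slope is zero at each point of differentiability.
  · filter_upwards [LocallyIntegrable.ae_hasDerivAt_integral hbl, hlip.ae_differentiableAt_real] with s hs hs'
    have hWd : HasDerivAt W (-b s) s := by simpa [hW] using (hs t).const_sub D
    refine ⟨fun h => ?_, fun h => ?_⟩
    · have h' : 0 < W s := by simpa using h
      refine hWd.congr_of_eventuallyEq ?_
      filter_upwards [hWd.continuousAt.eventually (lt_mem_nhds h')] with r hr
      exact max_eq_left hr.le
    · have : IsLocalMin (fun s => max (W s) 0) s := by
        refine Eventually.of_forall fun r => ?_
        show max (W s) 0 ≤ max (W r) 0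
        rw [show max (W s) 0 = 0 from h]
        exact le_max_right _ _
      have h0 := this.hasDerivAt_eq_zero hs'.hasDerivAt
      have := hs'.hasDerivAt
      rwa [h0] at this

theorem rpow_sub_one_mul_self {p a : ℝ} (hp : 1 < p) (ha : 0 ≤ a) : a ^ (p - 1) * a = a ^ p := by
  rcases ha.eq_or_lt with rfl | ha'
  · simp [Real.zero_rpow (show p ≠ 0 by linarith)]
  · rw [← Real.rpow_add_one ha'.ne']; ring_nf

/-- Young's inequality in the form used for coercivity. -/
theorem exists_mul_le_mul_rpow_add {p c : ℝ} (hp : 1 < p) (hc : 0 < c) (Λ : ℝ) :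
    ∃ C, 0 ≤ C ∧ ∀ a : ℝ, 0 ≤ a → Λ * a ≤ c * a ^ p + C := by
  have h : Tendsto (fun a : ℝ => c * a ^ (p - 1)) atTop atTop :=
    (tendsto_rpow_atTop (by linarith)).const_mul_atTop hc
  obtain ⟨A, hA⟩ := (h.eventually_ge_atTop Λ).exists_forall_of_atTop
  refine ⟨|Λ| * |A|, by positivity, fun a ha => ?_⟩
  rcases le_total a A with h1 | h1
  · have h2 : Λ * a ≤ |Λ| * |A| :=
      mul_le_mul (le_abs_self _) (h1.trans (le_abs_self _)) ha (abs_nonneg _)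
    have := mul_nonneg hc.le (Real.rpow_nonneg ha p)
    linarith
  · have h2 := mul_le_mul_of_nonneg_right (hA a h1) ha
    rw [mul_assoc, rpow_sub_one_mul_self hp ha] at h2
    have : 0 ≤ |Λ| * |A| := by positivity
    linarith

theorem le_one_add_rpow {p a : ℝ} (hp : 1 ≤ p) (ha : 0 ≤ a) : a ≤ 1 + a ^ p := by
  rcases le_total a 1 with h | h
  · linarith [Real.rpow_nonneg ha p]
  · linarith [Real.self_le_rpow_of_one_le h hp]

namespace JunctionControl

/-! ### Geometry of the junction -/

variable {N : ℕ}

/-- The point at distance `r` from the vertex on the edge `i`. -/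
def pt (i : Fin N) (r : ℝ) : E N := r • EuclideanSpace.single i (1 : ℝ)

theorem pt_apply_self (i : Fin N) (r : ℝ) : pt i r i = r := by simp [pt]

theorem pt_apply_ne {i j : Fin N} (h : j ≠ i) (r : ℝ) : pt i r j = 0 := by simp [pt, h]

theorem pt_zero (i : Fin N) : pt i 0 = 0 := by simp [pt]

theorem pt_mem_edge (i : Fin N) {r : ℝ} (hr : 0 ≤ r) : pt i r ∈ edge i := ⟨r, hr, rfl⟩

theorem edge_subset (i : Fin N) : edge i ⊆ junction N := subset_iUnion _ i

theorem pt_mem (i : Fin N) {r : ℝ} (hr : 0 ≤ r) : pt i r ∈ junction N :=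
  edge_subset i (pt_mem_edge i hr)

theorem norm_pt (i : Fin N) {r : ℝ} (hr : 0 ≤ r) : ‖pt i r‖ = r := by
  simp [pt, norm_smul, abs_of_nonneg hr]

theorem pt_sub (i : Fin N) (r s : ℝ) : pt i r - pt i s = pt i (r - s) := by
  simp [pt, sub_smul]

theorem pt_add (i : Fin N) (r s : ℝ) : pt i r + pt i s = pt i (r + s) := by
  simp [pt, add_smul]

theorem norm_pt_abs (i : Fin N) (r : ℝ) : ‖pt i r‖ = |r| := by
  simp [pt, norm_smul]

theorem eq_pt_of_forall {i : Fin N} {x : E N} (h : ∀ j, j ≠ i → x j = 0) : x = pt i (x i) := by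
  ext j
  rcases eq_or_ne j i with rfl | hj
  · rw [pt_apply_self]
  · rw [pt_apply_ne hj, h j hj]

theorem mem_edge_iff {i : Fin N} {x : E N} : x ∈ edge i ↔ 0 ≤ x i ∧ ∀ j, j ≠ i → x j = 0 := by
  constructor
  · rintro ⟨r, hr, rfl⟩
    exact ⟨by simpa using hr, fun j hj => by simp [hj]⟩
  · rintro ⟨h0, h⟩
    exact ⟨x i, h0, eq_pt_of_forall h⟩

theorem eq_pt_of_mem_edge {i : Fin N} {x : E N} (h : x ∈ edge i) : x = pt i (x i) :=
  eq_pt_of_forall (mem_edge_iff.1 h).2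

theorem norm_of_mem_edge {i : Fin N} {x : E N} (h : x ∈ edge i) : ‖x‖ = x i := by
  conv_lhs => rw [eq_pt_of_mem_edge h]
  exact norm_pt i (mem_edge_iff.1 h).1

theorem pos_of_mem_edge {i : Fin N} {x : E N} (h : x ∈ edge i) (hx : x ≠ 0) : 0 < x i := by
  rw [← norm_of_mem_edge h]; exact norm_pos_iff.2 hx

theorem mem_junction_iff {x : E N} : x ∈ junction N ↔ ∃ i, x ∈ edge i := by simp [junction]

theorem nonneg_of_mem {x : E N} (h : x ∈ junction N) (j : Fin N) : 0 ≤ x j := by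
  obtain ⟨i, hi⟩ := mem_junction_iff.1 h
  rcases eq_or_ne j i with rfl | hj
  · exact (mem_edge_iff.1 hi).1
  · exact ((mem_edge_iff.1 hi).2 j hj).ge

theorem mem_edge_of_pos {x : E N} (h : x ∈ junction N) {i : Fin N} (hi : 0 < x i) :
    x ∈ edge i := by
  obtain ⟨j, hj⟩ := mem_junction_iff.1 h
  rcases eq_or_ne i j with rfl | hij
  · exact hj
  · exact absurd ((mem_edge_iff.1 hj).2 i hij) hi.ne'

theorem zero_mem_edge (i : Fin N) : (0 : E N) ∈ edge i := ⟨0, le_rfl, by simp⟩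

theorem isClosed_edge (i : Fin N) : IsClosed (edge i) := by
  have : edge i = {x : E N | 0 ≤ x i} ∩ ⋂ j, ⋂ (_ : j ≠ i), {x : E N | x j = 0} := by
    ext x; simp [mem_edge_iff]
  rw [this]
  have hc : ∀ j, Continuous fun x : E N => x j := fun j => by fun_prop
  exact (isClosed_le continuous_const (hc i)).inter
    (isClosed_iInter fun j => isClosed_iInter fun _ => isClosed_eq (hc j) continuous_const)

theorem norm_le_sum_abs (v : E N) : ‖v‖ ≤ ∑ j, |v j| := by
  have h : v = ∑ j, pt j (v j) := by
    ext k
    simp [pt, Pi.single_apply]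
  conv_lhs => rw [h]
  refine (norm_sum_le _ _).trans (Finset.sum_le_sum fun j _ => ?_)
  rw [norm_pt_abs]

theorem geoDist_pt (i : Fin N) {r s : ℝ} (hr : 0 ≤ r) (hs : 0 ≤ s) :
    geoDist (pt i r) (pt i s) = |r - s| := by
  rw [geoDist, if_pos ⟨i, pt_mem_edge i hr, pt_mem_edge i hs⟩, pt_sub, norm_pt_abs]

theorem geoDist_of_not {x y : E N} (h : ¬ ∃ i, x ∈ edge i ∧ y ∈ edge i) :
    geoDist x y = ‖x‖ + ‖y‖ := if_neg h

theorem geoDist_comm (x y : E N) : geoDist x y = geoDist y x := by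
  unfold geoDist
  by_cases h : ∃ i, x ∈ edge i ∧ y ∈ edge i
  · rw [if_pos h, if_pos (h.imp fun _ => And.symm), norm_sub_rev]
  · rw [if_neg h, if_neg fun h' => h (h'.imp fun _ => And.symm), add_comm]

theorem norm_sub_le_geoDist (x y : E N) : ‖x - y‖ ≤ geoDist x y := by
  unfold geoDist
  split_ifs
  · exact le_rfl
  · exact norm_sub_le x y

/-- For points on different edges, each norm is a coordinate of `x - y` up to sign. -/
theorem geoDist_le_two_mul {x y : E N} (hx : x ∈ junction N) (hy : y ∈ junction N) :
    geoDist x y ≤ 2 * ‖x - y‖ := by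
  unfold geoDist
  split_ifs with h
  · linarith [norm_nonneg (x - y)]
  · obtain ⟨i, hi⟩ := mem_junction_iff.1 hx
    obtain ⟨j, hj⟩ := mem_junction_iff.1 hy
    have hij : i ≠ j := by
      rintro rfl; exact h ⟨i, hi, hj⟩
    have h1 := PiLp.norm_apply_le (x - y) i
    have h2 := PiLp.norm_apply_le (x - y) j
    simp only [PiLp.sub_apply, Real.norm_eq_abs] at h1 h2
    rw [(mem_edge_iff.1 hj).2 i hij, sub_zero] at h1
    rw [(mem_edge_iff.1 hi).2 j hij.symm, zero_sub, abs_neg] at h2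
    rw [norm_of_mem_edge hi, norm_of_mem_edge hj]
    linarith [le_abs_self (x i), le_abs_self (y j)]

/-- Every point of the junction is moved by `D` towards the vertex, where it stops. -/
def shrink (D : ℝ) (x : E N) : E N := WithLp.toLp 2 fun j => max (x j - D) 0

theorem shrink_apply (D : ℝ) (x : E N) (j : Fin N) : shrink D x j = max (x j - D) 0 := rfl

theorem shrink_pt (i : Fin N) {r D : ℝ} (hD : 0 ≤ D) :
    shrink D (pt i r) = pt i (max (r - D) 0) := by
  ext j
  rcases eq_or_ne j i with rfl | hj
  · rw [shrink_apply, pt_apply_self, pt_apply_self]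
  · rw [shrink_apply, pt_apply_ne hj, pt_apply_ne hj]; simp [hD]

theorem shrink_mem {D : ℝ} (hD : 0 ≤ D) {x : E N} (hx : x ∈ junction N) :
    shrink D x ∈ junction N := by
  obtain ⟨i, hi⟩ := mem_junction_iff.1 hx
  rw [eq_pt_of_mem_edge hi, shrink_pt i hD]
  exact pt_mem i (le_max_right _ _)

theorem shrink_norm_self {x : E N} (hx : x ∈ junction N) : shrink ‖x‖ x = 0 := by
  obtain ⟨i, hi⟩ := mem_junction_iff.1 hx
  have h : shrink ‖x‖ (pt i (x i)) = 0 := by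
    rw [shrink_pt i (norm_nonneg _), norm_of_mem_edge hi]; simp [pt_zero]
  rwa [← eq_pt_of_mem_edge hi] at h

theorem norm_shrink_le {D : ℝ} (hD : 0 ≤ D) {x : E N} (hx : x ∈ junction N) :
    ‖shrink D x‖ ≤ ‖x‖ := by
  obtain ⟨i, hi⟩ := mem_junction_iff.1 hx
  have h0 := (mem_edge_iff.1 hi).1
  rw [norm_of_mem_edge hi]
  rw [eq_pt_of_mem_edge hi, shrink_pt i hD, norm_pt i (le_max_right _ _), pt_apply_self]
  exact max_le (by linarith) h0

/-- Truncation is nonexpansive in each coordinate. The factor `N` from summing coordinates is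
harmless: only the regularity of displaced curves depends on it, not their cost. -/
theorem dist_shrink_le (D D' : ℝ) (x y : E N) :
    dist (shrink D x) (shrink D' y) ≤ N * (dist x y + dist D D') := by
  rw [dist_eq_norm]
  refine (norm_le_sum_abs _).trans ?_
  calc ∑ j, |(shrink D x - shrink D' y) j| ≤ ∑ _j : Fin N, (dist x y + dist D D') := by
        refine Finset.sum_le_sum fun j _ => ?_
        have h1 := PiLp.norm_apply_le (x - y) j
        simp only [PiLp.sub_apply, Real.norm_eq_abs] at h1
        rw [PiLp.sub_apply, shrink_apply, shrink_apply, dist_eq_norm, Real.dist_eq]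
        have h2 := abs_max_sub_max_le_max (x j - D) 0 (y j - D') 0
        simp only [sub_self, abs_zero, abs_nonneg, max_eq_left] at h2
        refine h2.trans ?_
        rw [show x j - D - (y j - D') = (x j - y j) - (D - D') by ring]
        exact (abs_sub _ _).trans (add_le_add h1 le_rfl)
    _ = _ := by simp [mul_add]

/-! ### Costs on the open edges and at the vertex -/

namespace Problem

variable (P : Problem N)

theorem indicator_sum_of_mem {i : Fin N} {y : E N} (hy : y ∈ edge i) (h0 : y ≠ 0)
    (f : Fin N → E N → ℝ) :
    ∑ j : Fin N, (edge j \ {0}).indicator (f j) y = f i y := by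
  rw [Finset.sum_eq_single i]
  · exact indicator_of_mem (s := edge i \ {0}) ⟨hy, h0⟩ _
  · intro j _ hj
    refine indicator_of_notMem (fun h : y ∈ edge j \ {0} => ?_) _
    have h1 := pos_of_mem_edge h.1 h0
    exact h1.ne' ((mem_edge_iff.1 hy).2 j hj)
  · simp

theorem runningCost_of_mem {i : Fin N} {y : E N} (hy : y ∈ edge i) (h0 : y ≠ 0) (α : E N) (s : ℝ) :
    P.runningCost y α s = P.ell i (y i) (α i) s := by
  rw [runningCost, indicator_sum_of_mem hy h0 fun j z => P.ell j ‖z‖ (α j) s,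
    indicator_of_notMem (by simpa using h0), add_zero, norm_of_mem_edge hy]

theorem runningCost_zero (α : E N) (s : ℝ) : P.runningCost 0 α s = P.ellZero s := by
  rw [runningCost, indicator_of_mem (mem_singleton _), Finset.sum_eq_zero, zero_add]
  intro j _
  exact indicator_of_notMem (by simp) _

theorem terminalCost_of_mem {i : Fin N} {y : E N} (hy : y ∈ edge i) (h0 : y ≠ 0) :
    P.terminalCost y = P.g i (y i) := by
  rw [terminalCost, indicator_sum_of_mem hy h0 fun j z => P.g j ‖z‖,
    indicator_of_notMem (by simpa using h0), add_zero, norm_of_mem_edge hy]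

theorem terminalCost_zero : P.terminalCost (0 : E N) = min P.gStar (⨅ i : Fin N, P.g i 0) := by
  rw [terminalCost, indicator_of_mem (mem_singleton _), Finset.sum_eq_zero, zero_add]
  intro j _
  exact indicator_of_notMem (by simp) _

theorem terminalCost_zero_le (i : Fin N) : P.terminalCost (0 : E N) ≤ P.g i 0 := by
  rw [terminalCost_zero]
  exact (min_le_right _ _).trans (ciInf_le (Finite.bddBelow_range _) i)

end Problem

end JunctionControl

namespace JunctionControl

variable {N : ℕ}

namespace Problem

/-! ### Bounds on the costs over bounded parts of the junction -/

/-- Bounds on the costs at distance at most `R` from the vertex. -/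
structure Bounds (P : Problem N) (R C₀ c₀ K : ℝ) : Prop where
  T_pos : 0 < P.T
  one_lt_p : 1 < P.p
  C_pos : 0 < C₀
  K_nonneg : 0 ≤ K
  lower : ∀ i, ∀ y : ℝ, 0 ≤ y → ∀ a : ℝ, ∀ s ∈ Icc 0 P.T, C₀ * |a| ^ P.p + c₀ ≤ P.ell i y a s
  lower_zero : ∀ s ∈ Icc 0 P.T, c₀ ≤ P.ellZero s
  upper : ∀ i, ∀ y ∈ Icc 0 R, ∀ a : ℝ, ∀ s ∈ Icc 0 P.T, P.ell i y a s ≤ K * (|a| ^ P.p + 1)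
  upper_zero : ∀ s ∈ Icc 0 P.T, P.ellZero s ≤ K
  lip : ∀ i, ∀ y₁ ∈ Icc 0 R, ∀ y₂ ∈ Icc 0 R, ∀ a : ℝ, ∀ s ∈ Icc 0 P.T,
    P.ell i y₁ a s - P.ell i y₂ a s ≤ K * (|a| ^ P.p + 1) * |y₁ - y₂|
  g_lip : ∀ i, ∀ y₁ ∈ Icc 0 R, ∀ y₂ ∈ Icc 0 R, P.g i y₁ - P.g i y₂ ≤ K * |y₁ - y₂|

variable {P : Problem N}

theorem exists_abs_terminalCost_le (hP : P.Standing) :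
    ∃ G, ∀ x ∈ junction N, |P.terminalCost x| ≤ G := by
  choose M hM using hP.g_bdd
  refine ⟨(∑ i, |M i|) + |P.terminalCost 0|, fun x hx => ?_⟩
  have hs : ∀ i, |M i| ≤ ∑ i, |M i| := fun i =>
    Finset.single_le_sum (f := fun i => |M i|) (fun j _ => abs_nonneg _) (Finset.mem_univ i)
  rcases eq_or_ne x 0 with rfl | h0
  · have : (0 : ℝ) ≤ ∑ i, |M i| := Finset.sum_nonneg fun i _ => abs_nonneg _
    linarith
  · obtain ⟨i, hi⟩ := mem_junction_iff.1 hx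
    rw [terminalCost_of_mem P hi h0]
    have := hM i (x i) (mem_edge_iff.1 hi).1
    linarith [hs i, le_abs_self (M i), abs_nonneg (P.terminalCost (0 : E N))]

theorem differentiable_ell_right (hP : P.Standing) (i : Fin N) {y s : ℝ} (hy : 0 ≤ y)
    (hs : s ∈ Icc 0 P.T) : Differentiable ℝ fun b => P.ell i y b s := by
  have h := (hP.ell_diff i s hs).comp (f := fun b : ℝ => (y, b)) (s := univ)
    (by fun_prop) (fun b _ => ⟨hy, mem_univ _⟩)
  exact differentiableOn_univ.1 h

theorem differentiableOn_ell_left (hP : P.Standing) (i : Fin N) (a : ℝ) {s : ℝ}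
    (hs : s ∈ Icc 0 P.T) : DifferentiableOn ℝ (fun z => P.ell i z a s) (Ici 0) :=
  (hP.ell_diff i s hs).comp (f := fun z : ℝ => (z, a)) (s := Ici 0)
    (by fun_prop) (fun _ hz => ⟨hz, mem_univ _⟩)

/-- Mean value inequality on `[-|a|, |a|]`; the product `(|a|^(p-1) + 1) * |a|` is at most `2 *
(|a|^p + 1)`. -/
theorem ell_le_of_daEll_le (hP : P.Standing) (i : Fin N) {y s c : ℝ} (hy : 0 ≤ y)
    (hs : s ∈ Icc 0 P.T) (hc : 0 ≤ c) (h : ∀ a, |P.daEll i y a s| ≤ c * (|a| ^ (P.p - 1) + 1))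
    (a : ℝ) : P.ell i y a s ≤ P.ell i y 0 s + 2 * c * (|a| ^ P.p + 1) := by
  have hp := hP.one_lt_p
  have hconv : Convex ℝ (Icc (-|a|) |a|) := convex_Icc _ _
  have h1 := hconv.norm_image_sub_le_of_norm_deriv_le (𝕜 := ℝ) (f := fun b => P.ell i y b s)
    (C := c * (|a| ^ (P.p - 1) + 1)) (x := 0) (y := a)
    (fun b _ => (differentiable_ell_right hP i hy hs) b) (fun b hb => ?_)
    (by simp) (by simp [neg_abs_le, le_abs_self])
  · rw [Real.norm_eq_abs, Real.norm_eq_abs, sub_zero, mul_assoc, add_mul, one_mul,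
      rpow_sub_one_mul_self hp (abs_nonneg a)] at h1
    have h2 := le_one_add_rpow hp.le (abs_nonneg a)
    have h3 : c * (|a| ^ P.p + |a|) ≤ c * (2 * (|a| ^ P.p + 1)) := by
      refine mul_le_mul_of_nonneg_left ?_ hc
      linarith
    linarith [le_abs_self (P.ell i y a s - P.ell i y 0 s)]
  · refine (h b).trans (mul_le_mul_of_nonneg_left ?_ hc)
    have : |b| ^ (P.p - 1) ≤ |a| ^ (P.p - 1) :=
      Real.rpow_le_rpow (abs_nonneg _) (abs_le.2 hb) (by linarith)
    linarith

theorem ell_sub_le_of_dyEll_le (hP : P.Standing) (i : Fin N) {a s R C : ℝ}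
    (hs : s ∈ Icc 0 P.T) (h : ∀ y ∈ Icc 0 R, |P.dyEll i y a s| ≤ C) {y₁ y₂ : ℝ}
    (h1 : y₁ ∈ Icc 0 R) (h2 : y₂ ∈ Icc 0 R) :
    P.ell i y₁ a s - P.ell i y₂ a s ≤ C * |y₁ - y₂| := by
  have := (convex_Icc 0 R).norm_image_sub_le_of_norm_hasDerivWithin_le (𝕜 := ℝ)
    (f := fun z => P.ell i z a s) (f' := fun z => P.dyEll i z a s) (C := C) (x := y₂) (y := y₁)
    (fun z hz => ((differentiableOn_ell_left hP i a hs) z hz.1).hasDerivWithinAt.mono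
      Icc_subset_Ici_self) h h2 h1
  exact (le_abs_self _).trans this

theorem continuousOn_ellZero (hP : P.Standing) (hN : 0 < N) : ContinuousOn P.ellZero (Icc 0 P.T) := by
  have : Nonempty (Fin N) := ⟨⟨0, hN⟩⟩
  have h : ∀ i ∈ (Finset.univ : Finset (Fin N)),
      ContinuousOn (fun s => P.ell i 0 0 s) (Icc 0 P.T) := fun i _ =>
    (hP.ell_cont i).comp (f := fun s : ℝ => ((0 : ℝ), (0 : ℝ), s)) (by fun_prop)
      (fun s hs => ⟨by simp, mem_univ _, hs⟩)
  have h2 := ContinuousOn.finset_inf'_apply Finset.univ_nonempty h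
  simp only [Finset.inf'_univ_eq_ciInf] at h2
  exact ContinuousOn.inf hP.ellStar_cont h2

theorem exists_bounds (hN : 0 < N) (hP : P.Standing) (h1 : P.H1) (h3 : P.H3) (h5 : P.H5) :
    ∃ C₀ c₀, ∀ R, 0 < R → ∃ K, P.Bounds R C₀ c₀ K := by
  have : Nonempty (Fin N) := ⟨⟨0, hN⟩⟩
  obtain ⟨C₀, c₀, hC₀, hl, hl'⟩ := h1
  refine ⟨C₀, c₀, fun R hR => ?_⟩
  obtain ⟨c, hc, hc'⟩ := h3 R hR
  have hm : ∀ i : Fin N, ∃ m, ∀ q ∈ Icc (0 : ℝ) R ×ˢ Icc 0 P.T, P.ell i q.1 0 q.2 ≤ m := by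
    intro i
    have hcont : ContinuousOn (fun q : ℝ × ℝ => P.ell i q.1 0 q.2) (Icc (0 : ℝ) R ×ˢ Icc 0 P.T) :=
      (hP.ell_cont i).comp (f := fun q : ℝ × ℝ => (q.1, (0 : ℝ), q.2)) (by fun_prop)
        (fun q hq => ⟨hq.1.1, mem_univ _, hq.2⟩)
    obtain ⟨m, hm⟩ := (isCompact_Icc.prod isCompact_Icc).bddAbove_image hcont
    exact ⟨m, fun q hq => hm ⟨q, hq, rfl⟩⟩
  choose m hm using hm
  have hg : ∀ i : Fin N, ∃ L : NNReal, LipschitzOnWith L (P.g i) (Icc 0 R) := fun i =>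
    ((h5 i).mono Icc_subset_Ici_self).exists_lipschitzOnWith one_ne_zero (convex_Icc _ _)
      isCompact_Icc
  choose L hL using hg
  obtain ⟨z, hz⟩ := isCompact_Icc.bddAbove_image (continuousOn_ellZero hP hN)
  set K : ℝ := (∑ i, |m i|) + (∑ i, (L i : ℝ)) + 2 * c + |z| with hK
  have hsm : ∀ i, |m i| ≤ ∑ i, |m i| := fun i =>
    Finset.single_le_sum (f := fun i => |m i|) (fun j _ => abs_nonneg _) (Finset.mem_univ i)
  have hsL : ∀ i, (L i : ℝ) ≤ ∑ i, (L i : ℝ) := fun i =>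
    Finset.single_le_sum (f := fun i => (L i : ℝ)) (fun j _ => (L j).2) (Finset.mem_univ i)
  have hm0 : 0 ≤ ∑ i, |m i| := Finset.sum_nonneg fun i _ => abs_nonneg _
  have hL0 : 0 ≤ ∑ i, (L i : ℝ) := Finset.sum_nonneg fun i _ => (L i).2
  have hz0 := abs_nonneg z
  refine ⟨K, hP.T_pos, hP.one_lt_p, hC₀, by positivity, hl, ?_, ?_, ?_, ?_, ?_⟩
  · intro s hs
    refine le_min (hl' s hs) (le_ciInf fun i => ?_)
    have := hl i 0 le_rfl 0 s hs
    rwa [abs_zero, Real.zero_rpow (by linarith [hP.one_lt_p]), mul_zero, zero_add] at this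
  · intro i y hy a s hs
    have h1 := ell_le_of_daEll_le hP i hy.1 hs hc (fun a => (hc' i y hy a s hs).2) a
    have h2 := hm i (y, s) ⟨hy, hs⟩
    have h4 := Real.rpow_nonneg (abs_nonneg a) P.p
    have h5 : (∑ i, |m i|) * 1 ≤ (∑ i, |m i|) * (|a| ^ P.p + 1) :=
      mul_le_mul_of_nonneg_left (by linarith) hm0
    have h6 : (2 * c + ∑ i, |m i|) * (|a| ^ P.p + 1) ≤ K * (|a| ^ P.p + 1) :=
      mul_le_mul_of_nonneg_right (by rw [hK]; linarith) (by linarith)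
    linarith [hsm i, le_abs_self (m i)]
  · intro s hs
    linarith [hz ⟨s, hs, rfl⟩, le_abs_self z]
  · intro i y₁ hy₁ y₂ hy₂ a s hs
    refine (ell_sub_le_of_dyEll_le hP i hs (fun y hy => (hc' i y hy a s hs).1) hy₁ hy₂).trans ?_
    refine mul_le_mul_of_nonneg_right (mul_le_mul_of_nonneg_right (by linarith) ?_) (abs_nonneg _)
    linarith [Real.rpow_nonneg (abs_nonneg a) P.p]
  · intro i y₁ hy₁ y₂ hy₂
    have h := (hL i).dist_le_mul y₁ hy₁ y₂ hy₂
    rw [Real.dist_eq, Real.dist_eq] at h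
    have h2 : (L i : ℝ) * |y₁ - y₂| ≤ K * |y₁ - y₂| :=
      mul_le_mul_of_nonneg_right (by linarith [hsL i]) (abs_nonneg _)
    linarith [le_abs_self (P.g i y₁ - P.g i y₂)]

end Problem

/-! ### Trajectories on an interval -/

/-- An absolutely continuous curve in the junction, with derivative in `L^p`. -/
structure Traj (p a b : ℝ) (y : ℝ → E N) : Prop where
  mem : ∀ s ∈ Icc a b, y s ∈ junction N
  absCont : AbsolutelyContinuousOnInterval y a b
  memLp : MemLp (deriv y) (ENNReal.ofReal p) (volume.restrict (Ioo a b))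

theorem Problem.admissible_iff {P : Problem N} {t : ℝ} {x : E N} {y : ℝ → E N} :
    P.Admissible t x y ↔ Traj P.p t P.T y ∧ y t = x :=
  ⟨fun h => ⟨⟨h.mem, h.absCont, h.deriv_memLp⟩, h.start⟩,
    fun h => ⟨h.1.mem, h.2, h.1.absCont, h.1.memLp⟩⟩

theorem hasDerivAt_coord {y : ℝ → E N} {s : ℝ} (h : DifferentiableAt ℝ y s) (i : Fin N) :
    HasDerivAt (fun r => y r i) (deriv y s i) s :=
  (EuclideanSpace.proj (𝕜 := ℝ) i).hasFDerivAt.comp_hasDerivAt s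
    h.hasDerivAt

theorem deriv_ite_of_lt (y z : ℝ → E N) {s b : ℝ} (hs : s < b) :
    deriv (fun s => if s ≤ b then y s else z s) s = deriv y s := by
  refine EventuallyEq.deriv_eq ?_
  filter_upwards [gt_mem_nhds hs] with r hr
  simp [le_of_lt hr]

theorem deriv_ite_of_gt (y z : ℝ → E N) {s b : ℝ} (hs : b < s) :
    deriv (fun s => if s ≤ b then y s else z s) s = deriv z s := by
  refine EventuallyEq.deriv_eq ?_
  filter_upwards [lt_mem_nhds hs] with r hr
  simp [hr]

namespace Traj

variable {p a b : ℝ} {y : ℝ → E N}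

theorem continuousOn (h : Traj p a b y) (hab : a ≤ b) : ContinuousOn y (Icc a b) := by
  have := h.absCont.continuousOn
  rwa [uIcc_of_le hab] at this

theorem mono (h : Traj p a b y) {c d : ℝ} (hac : a ≤ c) (hcd : c ≤ d) (hdb : d ≤ b) :
    Traj p c d y where
  mem s hs := h.mem s ⟨hac.trans hs.1, hs.2.trans hdb⟩
  absCont := h.absCont.mono (by
    rw [uIcc_of_le hcd, uIcc_of_le (hac.trans (hcd.trans hdb))]; exact Icc_subset_Icc hac hdb)
  memLp := h.memLp.mono_measure (Measure.restrict_mono (Ioo_subset_Ioo hac hdb) le_rfl)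

theorem ae_differentiableAt (h : Traj p a b y) (hab : a ≤ b) :
    ∀ᵐ s, s ∈ Ioo a b → DifferentiableAt ℝ y s := by
  filter_upwards [h.absCont.boundedVariationOn.ae_differentiableAt_of_mem_uIcc] with s hs hs'
  exact hs (by rw [uIcc_of_le hab]; exact Ioo_subset_Icc_self hs')

/-- Coordinates are nonnegative on the junction, so a vanishing coordinate is at a local minimum.
Hence the velocity is tangent to the current edge, and is zero at the vertex. -/
theorem deriv_coord_eq_zero (h : Traj p a b y) {s : ℝ} (hs : s ∈ Ioo a b)
    (hd : DifferentiableAt ℝ y s) {j : Fin N} (hj : y s j = 0) : deriv y s j = 0 := by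
  refine IsLocalMin.hasDerivAt_eq_zero ?_ (hasDerivAt_coord hd j)
  filter_upwards [isOpen_Ioo.mem_nhds hs] with r hr
  rw [hj]
  exact nonneg_of_mem (h.mem r (Ioo_subset_Icc_self hr)) j

theorem norm_deriv_eq (h : Traj p a b y) {s : ℝ} (hs : s ∈ Ioo a b)
    (hd : DifferentiableAt ℝ y s) {i : Fin N} (hi : y s ∈ edge i) :
    ‖deriv y s‖ = |deriv y s i| := by
  have : deriv y s = pt i (deriv y s i) :=
    eq_pt_of_forall fun j hj => h.deriv_coord_eq_zero hs hd ((mem_edge_iff.1 hi).2 j hj)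
  conv_lhs => rw [this]
  exact norm_pt_abs _ _

theorem norm_deriv_eq_zero (h : Traj p a b y) {s : ℝ} (hs : s ∈ Ioo a b)
    (hd : DifferentiableAt ℝ y s) (h0 : y s = 0) : ‖deriv y s‖ = 0 := by
  rw [norm_eq_zero]
  ext j
  exact h.deriv_coord_eq_zero hs hd (by simp [h0])

theorem _root_.JunctionControl.memLp_deriv_iff (hp : 1 < p) (hab : a ≤ b) :
    MemLp (deriv y) (ENNReal.ofReal p) (volume.restrict (Ioo a b)) ↔
      IntervalIntegrable (fun s => ‖deriv y s‖ ^ p) volume a b := by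
  rw [intervalIntegrable_iff_integrableOn_Ioo_of_le hab, IntegrableOn,
    ← integrable_norm_rpow_iff (measurable_deriv y).aestronglyMeasurable
      (by simpa using hp.trans' zero_lt_one) (by simp), ENNReal.toReal_ofReal (by linarith)]

theorem intervalIntegrable_rpow (h : Traj p a b y) (hp : 1 < p) (hab : a ≤ b) :
    IntervalIntegrable (fun s => ‖deriv y s‖ ^ p) volume a b :=
  (memLp_deriv_iff hp hab).1 h.memLp

theorem intervalIntegrable_norm (h : Traj p a b y) (hp : 1 < p) (hab : a ≤ b) :
    IntervalIntegrable (fun s => ‖deriv y s‖) volume a b := by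
  refine (h.intervalIntegrable_rpow hp hab |>.add (intervalIntegrable_const (c := (1:ℝ)))).mono_fun
    (measurable_deriv y).norm.aestronglyMeasurable (Eventually.of_forall fun s => ?_)
  have h1 := le_one_add_rpow hp.le (norm_nonneg (deriv y s))
  have h2 := Real.rpow_nonneg (norm_nonneg (deriv y s)) p
  show ‖‖deriv y s‖‖ ≤ ‖‖deriv y s‖ ^ p + 1‖
  rw [norm_norm, Real.norm_of_nonneg (by linarith)]
  linarith

/-- The fundamental theorem of calculus is applied to the scalar function `⟪v, y⟫` with `v = y b - y
a`, which gives `‖v‖² ≤ ‖v‖ ∫ ‖y'‖`. -/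
theorem norm_sub_le (h : Traj p a b y) (hp : 1 < p) (hab : a ≤ b) :
    ‖y b - y a‖ ≤ ∫ s in a..b, ‖deriv y s‖ := by
  set v := y b - y a with hv
  have hac : AbsolutelyContinuousOnInterval (fun s => inner ℝ v (y s)) a b := by
    refine AbsolutelyContinuousOnInterval.of_dist_le (C := ‖v‖) h.absCont h.absCont fun s r => ?_
    rw [Real.dist_eq, ← inner_sub_right, dist_eq_norm]
    refine (abs_real_inner_le_norm _ _).trans (mul_le_mul_of_nonneg_left ?_ (norm_nonneg _))
    linarith [norm_nonneg (y s - y r)]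
  have h1 := hac.integral_deriv_eq_sub
  rw [← inner_sub_right, ← hv, real_inner_self_eq_norm_mul_norm] at h1
  have h2 : ∫ s in a..b, deriv (fun s => inner ℝ v (y s)) s ≤ ∫ s in a..b, ‖v‖ * ‖deriv y s‖ := by
    refine intervalIntegral_mono_of_ae_Ioo hab hac.intervalIntegrable_deriv
      ((h.intervalIntegrable_norm hp hab).const_mul _) ?_
    filter_upwards [h.ae_differentiableAt hab] with s hs hs'
    have : HasDerivAt (fun s => inner ℝ v (y s)) (inner ℝ v (deriv y s)) s := by
      simpa using (hasDerivAt_const s v).inner ℝ (hs hs').hasDerivAt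
    rw [this.deriv]
    exact real_inner_le_norm _ _
  rw [h1, intervalIntegral.integral_const_mul] at h2
  rcases (norm_nonneg v).eq_or_lt with h0 | h0
  · rw [← h0]
    exact intervalIntegral.integral_nonneg hab fun s _ => norm_nonneg _
  · exact le_of_mul_le_mul_left h2 h0

theorem norm_sub_le_rpow (h : Traj p a b y) (hp : 1 < p) (hab : a ≤ b) :
    ‖y b - y a‖ ≤ (b - a) + ∫ s in a..b, ‖deriv y s‖ ^ p := by
  refine (h.norm_sub_le hp hab).trans ?_
  have h2 := intervalIntegral.integral_mono_on hab (h.intervalIntegrable_norm hp hab)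
    ((intervalIntegrable_const (c := (1:ℝ))).add (h.intervalIntegrable_rpow hp hab))
    (fun s _ => le_one_add_rpow hp.le (norm_nonneg _))
  refine h2.trans (le_of_eq ?_)
  rw [intervalIntegral.integral_add intervalIntegrable_const (h.intervalIntegrable_rpow hp hab)]
  simp

theorem concat {z : ℝ → E N} {c : ℝ} (hy : Traj p a b y) (hz : Traj p b c z) (hp : 1 < p)
    (hab : a ≤ b) (hbc : b ≤ c) (hyz : y b = z b) :
    Traj p a c fun s => if s ≤ b then y s else z s where
  mem s hs := by
    by_cases h : s ≤ b
    · simpa [h] using hy.mem s ⟨hs.1, h⟩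
    · simpa [h] using hz.mem s ⟨(not_le.1 h).le, hs.2⟩
  absCont := hy.absCont.concat hab hbc hz.absCont hyz
  memLp := by
    rw [memLp_deriv_iff hp (hab.trans hbc)]
    refine IntervalIntegrable.trans (b := b) ?_ ?_
    · rw [← memLp_deriv_iff hp hab]
      refine hy.memLp.ae_eq ((ae_restrict_mem measurableSet_Ioo).mono fun s hs => ?_)
      exact (deriv_ite_of_lt y z hs.2).symm
    · rw [← memLp_deriv_iff hp hbc]
      refine hz.memLp.ae_eq ((ae_restrict_mem measurableSet_Ioo).mono fun s hs => ?_)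
      exact (deriv_ite_of_gt y z hs.1).symm

end Traj

end JunctionControl

namespace JunctionControl

variable {N : ℕ} {P : Problem N} {R C₀ c₀ K a b : ℝ} {y : ℝ → E N}

/-! ### The running cost along a trajectory -/

namespace Problem

/-- The running cost at time `s` along the curve `y`. -/
def along (P : Problem N) (y : ℝ → E N) (s : ℝ) : ℝ := P.runningCost (y s) (deriv y s) s

namespace Bounds

/-- Coercivity survives at the vertex, although `ellZero` ignores the velocity, because the velocity
vanishes there. -/
theorem le_along (hB : P.Bounds R C₀ c₀ K) (hy : Traj P.p a b y) (ha : 0 ≤ a) (hb : b ≤ P.T)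
    {s : ℝ} (hs : s ∈ Ioo a b) (hd : DifferentiableAt ℝ y s) :
    C₀ * ‖deriv y s‖ ^ P.p + c₀ ≤ P.along y s := by
  have hsT : s ∈ Icc 0 P.T := ⟨ha.trans hs.1.le, hs.2.le.trans hb⟩
  have hp := hB.one_lt_p
  rcases eq_or_ne (y s) 0 with h0 | h0
  · rw [hy.norm_deriv_eq_zero hs hd h0, along, h0, runningCost_zero,
      Real.zero_rpow (by linarith), mul_zero, zero_add]
    exact hB.lower_zero s hsT
  · obtain ⟨i, hi⟩ := mem_junction_iff.1 (hy.mem s (Ioo_subset_Icc_self hs))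
    rw [hy.norm_deriv_eq hs hd hi, along, runningCost_of_mem P hi h0]
    exact hB.lower i _ (mem_edge_iff.1 hi).1 _ s hsT

theorem along_le (hB : P.Bounds R C₀ c₀ K) (hy : Traj P.p a b y) (ha : 0 ≤ a) (hb : b ≤ P.T)
    {s : ℝ} (hs : s ∈ Ioo a b) (hd : DifferentiableAt ℝ y s) (hR : ‖y s‖ ≤ R) :
    P.along y s ≤ K * (‖deriv y s‖ ^ P.p + 1) := by
  have hsT : s ∈ Icc 0 P.T := ⟨ha.trans hs.1.le, hs.2.le.trans hb⟩
  have hp := hB.one_lt_p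
  rcases eq_or_ne (y s) 0 with h0 | h0
  · rw [hy.norm_deriv_eq_zero hs hd h0, along, h0, runningCost_zero,
      Real.zero_rpow (by linarith), zero_add, mul_one]
    exact hB.upper_zero s hsT
  · obtain ⟨i, hi⟩ := mem_junction_iff.1 (hy.mem s (Ioo_subset_Icc_self hs))
    rw [hy.norm_deriv_eq hs hd hi, along, runningCost_of_mem P hi h0]
    rw [norm_of_mem_edge hi] at hR
    exact hB.upper i _ ⟨(mem_edge_iff.1 hi).1, hR⟩ _ s hsT

end Bounds

/-- Continuity of the costs is known only on `P.dom`, so they are extended by zero. The times spent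
inside edge `i` form an open set, and at the remaining times the curve is at the vertex. -/
theorem aestronglyMeasurable_along (hP : P.Standing) (hN : 0 < N) (hy : Traj P.p a b y)
    (ha : 0 ≤ a) (hab : a ≤ b) (hb : b ≤ P.T) :
    AEStronglyMeasurable (P.along y) (volume.restrict (Ioo a b)) := by
  classical
  have hsub : Ioo a b ⊆ Icc 0 P.T := fun s hs => ⟨ha.trans hs.1.le, hs.2.le.trans hb⟩
  have hcont : ContinuousOn y (Ioo a b) := (hy.continuousOn hab).mono Ioo_subset_Icc_self
  have hS : ∀ i : Fin N, MeasurableSet (Ioo a b ∩ {s | 0 < y s i}) := fun i => by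
    have hci : ContinuousOn (fun s => y s i) (Ioo a b) :=
      (PiLp.continuous_apply 2 _ i).comp_continuousOn hcont
    exact (hci.isOpen_inter_preimage isOpen_Ioo isOpen_Ioi).measurableSet
  have hdom : MeasurableSet P.dom :=
    measurableSet_Ici.prod (MeasurableSet.univ.prod measurableSet_Icc)
  have hF : ∀ i : Fin N,
      Measurable (P.dom.indicator fun q : ℝ × ℝ × ℝ => P.ell i q.1 q.2.1 q.2.2) := fun i => by
    rw [← piecewise_eq_indicator]
    exact (hP.ell_cont i).measurable_piecewise continuousOn_const hdom
  have hZ : Measurable ((Icc 0 P.T).indicator P.ellZero) := by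
    rw [← piecewise_eq_indicator]
    exact (continuousOn_ellZero hP hN).measurable_piecewise continuousOn_const measurableSet_Icc
  have hym : AEMeasurable y (volume.restrict (Ioo a b)) := hcont.aemeasurable measurableSet_Ioo
  have hyi : ∀ i : Fin N, AEMeasurable (fun s => y s i) (volume.restrict (Ioo a b)) := fun i =>
    (PiLp.continuous_apply 2 _ i).measurable.comp_aemeasurable hym
  have hdi : ∀ i : Fin N, Measurable fun s => deriv y s i := fun i =>
    (PiLp.continuous_apply 2 _ i).measurable.comp (measurable_deriv y)
  have hsum : AEMeasurable (fun s => (∑ i : Fin N, (Ioo a b ∩ {s | 0 < y s i}).indicator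
      (fun s => P.dom.indicator (fun q : ℝ × ℝ × ℝ => P.ell i q.1 q.2.1 q.2.2)
        (y s i, deriv y s i, s)) s)
      + (⋃ i : Fin N, Ioo a b ∩ {s | 0 < y s i})ᶜ.indicator
        ((Icc 0 P.T).indicator P.ellZero) s) (volume.restrict (Ioo a b)) := by
    refine AEMeasurable.add (Finset.aemeasurable_fun_sum _ fun i _ => ?_) ?_
    · refine AEMeasurable.indicator ?_ (hS i)
      exact (hF i).comp_aemeasurable ((hyi i).prodMk ((hdi i).aemeasurable.prodMk aemeasurable_id))
    · exact (hZ.indicator (MeasurableSet.iUnion hS).compl).aemeasurable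
  refine (hsum.congr ?_).aestronglyMeasurable
  refine (ae_restrict_mem measurableSet_Ioo).mono fun s hs => ?_
  have hsT := hsub hs
  rcases eq_or_ne (y s) 0 with h0 | h0
  · have h1 : ∀ i : Fin N, s ∉ Ioo a b ∩ {s | 0 < y s i} := fun i h => by
      have : 0 < y s i := h.2
      simp [h0] at this
    simp only [along, h0, runningCost_zero]
    rw [Finset.sum_eq_zero fun i _ => indicator_of_notMem (h1 i) _, zero_add,
      indicator_of_mem (by simpa only [mem_compl_iff, mem_iUnion, not_exists] using h1),
      indicator_of_mem hsT]
  · obtain ⟨i, hi⟩ := mem_junction_iff.1 (hy.mem s (Ioo_subset_Icc_self hs))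
    have hpos := pos_of_mem_edge hi h0
    have hmem : s ∈ Ioo a b ∩ {s | 0 < y s i} := ⟨hs, hpos⟩
    simp only [along]
    rw [runningCost_of_mem P hi h0, Finset.sum_eq_single i, indicator_of_mem hmem,
      indicator_of_mem (show (y s i, deriv y s i, s) ∈ P.dom from ⟨hpos.le, mem_univ _, hsT⟩),
      indicator_of_notMem, add_zero]
    · exact fun h => h (mem_iUnion.2 ⟨i, hmem⟩)
    · intro j _ hj
      refine indicator_of_notMem (fun h => ?_) _
      have : 0 < y s j := h.2
      exact this.ne' ((mem_edge_iff.1 hi).2 j hj)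
    · simp

theorem intervalIntegrable_along (hP : P.Standing) (hN : 0 < N) (hB : P.Bounds R C₀ c₀ K)
    (hy : Traj P.p a b y) (ha : 0 ≤ a) (hab : a ≤ b) (hb : b ≤ P.T)
    (hR : ∀ s ∈ Icc a b, ‖y s‖ ≤ R) : IntervalIntegrable (P.along y) volume a b := by
  have hp := hB.one_lt_p
  have hI := hy.intervalIntegrable_rpow hp hab
  have hint : IntervalIntegrable (fun s => K * (‖deriv y s‖ ^ P.p + 1) + |c₀|) volume a b :=
    ((hI.add intervalIntegrable_const).const_mul K).add intervalIntegrable_const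
  rw [intervalIntegrable_iff_integrableOn_Ioo_of_le hab] at hint ⊢
  refine Integrable.mono' hint (aestronglyMeasurable_along hP hN hy ha hab hb) ?_
  rw [ae_restrict_iff' measurableSet_Ioo]
  filter_upwards [hy.ae_differentiableAt hab] with s hs hs'
  have h1 := hB.le_along hy ha hb hs' (hs hs')
  have h2 := hB.along_le hy ha hb hs' (hs hs') (hR s (Ioo_subset_Icc_self hs'))
  have h3 := Real.rpow_nonneg (norm_nonneg (deriv y s)) P.p
  have h4 := mul_nonneg hB.C_pos.le h3
  have h5 := mul_nonneg hB.K_nonneg (show 0 ≤ ‖deriv y s‖ ^ P.p + 1 by linarith)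
  rw [Real.norm_eq_abs]
  refine abs_le.2 ⟨?_, ?_⟩
  · linarith [neg_abs_le c₀]
  · linarith [abs_nonneg c₀]

theorem Bounds.le_integral_along (hB : P.Bounds R C₀ c₀ K)
    (hy : Traj P.p a b y) (ha : 0 ≤ a) (hab : a ≤ b) (hb : b ≤ P.T)
    (hi : IntervalIntegrable (P.along y) volume a b) :
    C₀ * (∫ s in a..b, ‖deriv y s‖ ^ P.p) + c₀ * (b - a) ≤ ∫ s in a..b, P.along y s := by
  have hI := hy.intervalIntegrable_rpow hB.one_lt_p hab
  have h := intervalIntegral_mono_of_ae_Ioo hab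
    ((hI.const_mul C₀).add (intervalIntegrable_const (c := c₀))) hi (by
      filter_upwards [hy.ae_differentiableAt hab] with s hs hs'
      exact hB.le_along hy ha hb hs' (hs hs'))
  rw [intervalIntegral.integral_add (hI.const_mul C₀) intervalIntegrable_const,
    intervalIntegral.integral_const_mul] at h
  simpa [mul_comm] using h

/-! ### Coercivity, dynamic programming and a priori bounds -/

theorem cost_eq (t : ℝ) (y : ℝ → E N) :
    P.cost t y = (∫ s in t..P.T, P.along y s) + P.terminalCost (y P.T) := rfl

/-- The hypotheses on the data that are used in the proof. -/
structure Regular (P : Problem N) (C₀ c₀ G : ℝ) : Prop where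
  standing : P.Standing
  pos : 0 < N
  bounds : ∀ R, 0 < R → ∃ K, P.Bounds R C₀ c₀ K
  terminal : ∀ x ∈ junction N, |P.terminalCost x| ≤ G

namespace Regular

variable {G : ℝ}

/-- An absolutely continuous curve is bounded, so the bounds on a suitable ball apply to it. -/
theorem integrable (hR : P.Regular C₀ c₀ G) (hy : Traj P.p a b y) (ha : 0 ≤ a) (hab : a ≤ b)
    (hb : b ≤ P.T) : IntervalIntegrable (P.along y) volume a b := by
  obtain ⟨r, hr⟩ := hy.absCont.exists_bound
  obtain ⟨K, hK⟩ := hR.bounds (|r| + 1) (by positivity)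
  refine intervalIntegrable_along hR.standing hR.pos hK hy ha hab hb fun s hs => ?_
  have := hr s (by rwa [uIcc_of_le hab])
  linarith [le_abs_self r]

theorem le_integral (hR : P.Regular C₀ c₀ G) (hy : Traj P.p a b y) (ha : 0 ≤ a) (hab : a ≤ b)
    (hb : b ≤ P.T) :
    C₀ * (∫ s in a..b, ‖deriv y s‖ ^ P.p) + c₀ * (b - a) ≤ ∫ s in a..b, P.along y s := by
  obtain ⟨K, hK⟩ := hR.bounds 1 one_pos
  exact hK.le_integral_along hy ha hab hb (hR.integrable hy ha hab hb)

theorem one_lt_p (hR : P.Regular C₀ c₀ G) : 1 < P.p := hR.standing.one_lt_p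

theorem C_pos (hR : P.Regular C₀ c₀ G) : 0 < C₀ :=
  let ⟨_, hK⟩ := hR.bounds 1 one_pos
  hK.C_pos

theorem le_cost (hR : P.Regular C₀ c₀ G) {t : ℝ} (ht : t ∈ Icc 0 P.T) (hy : Traj P.p t P.T y) :
    C₀ * (∫ s in t..P.T, ‖deriv y s‖ ^ P.p) - |c₀| * P.T - G ≤ P.cost t y := by
  have h1 := hR.le_integral hy ht.1 ht.2 le_rfl
  have h2 := hR.terminal _ (hy.mem P.T ⟨ht.2, le_rfl⟩)
  have h3 : -(|c₀| * P.T) ≤ c₀ * (P.T - t) := by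
    have h4 : |c₀| * (P.T - t) ≤ |c₀| * P.T :=
      mul_le_mul_of_nonneg_left (by linarith [ht.1]) (abs_nonneg _)
    have h5 := mul_le_mul_of_nonneg_right (neg_abs_le c₀) (sub_nonneg.2 ht.2)
    linarith
  rw [cost_eq]
  linarith [(abs_le.1 h2).1]

theorem bddBelow (hR : P.Regular C₀ c₀ G) {t : ℝ} (ht : t ∈ Icc 0 P.T) (x : E N) :
    BddBelow (P.cost t '' {y | P.Admissible t x y}) := by
  refine ⟨-(|c₀| * P.T) - G, ?_⟩
  rintro _ ⟨y, hy, rfl⟩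
  have hy' := (admissible_iff.1 hy).1
  have := hR.le_cost ht hy'
  have h0 : 0 ≤ ∫ s in t..P.T, ‖deriv y s‖ ^ P.p :=
    intervalIntegral.integral_nonneg ht.2 fun s _ => Real.rpow_nonneg (norm_nonneg _) _
  linarith [mul_nonneg hR.C_pos.le h0]

theorem value_le_cost (hR : P.Regular C₀ c₀ G) {t : ℝ} (ht : t ∈ Icc 0 P.T)
    (hy : Traj P.p t P.T y) : P.value (y t) t ≤ P.cost t y :=
  csInf_le (hR.bddBelow ht _) ⟨y, admissible_iff.2 ⟨hy, rfl⟩, rfl⟩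

/-- Motion on an edge at constant velocity. -/
theorem traj_pt {p : ℝ} (hp : 1 < p) (hab : a ≤ b) (i : Fin N) (r v : ℝ)
    (h : ∀ s ∈ Icc a b, 0 ≤ r + v * (s - a)) : Traj p a b fun s => pt i (r + v * (s - a)) := by
  have hd : ∀ s, HasDerivAt (fun s => pt i (r + v * (s - a))) (pt i v) s := fun s => by
    have : HasDerivAt (fun s : ℝ => r + v * (s - a)) v s := by
      simpa using (((hasDerivAt_id s).sub_const a).const_mul v).const_add r
    exact this.smul_const _
  refine ⟨fun s hs => pt_mem i (h s hs), ?_, ?_⟩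
  · refine (LipschitzWith.of_dist_le_mul (K := ⟨|v|, abs_nonneg v⟩) fun s s' => ?_).lipschitzOnWith
      |>.absolutelyContinuousOnInterval
    rw [dist_eq_norm, pt_sub, norm_pt_abs, Real.dist_eq]
    show _ ≤ |v| * |s - s'|
    rw [← abs_mul]
    exact le_of_eq (by ring_nf)
  · rw [memLp_deriv_iff hp hab]
    simp only [(hd _).deriv]
    exact intervalIntegrable_const

theorem deriv_pt (i : Fin N) (r v a s : ℝ) :
    deriv (fun s => pt i (r + v * (s - a))) s = pt i v := by
  have : HasDerivAt (fun s : ℝ => r + v * (s - a)) v s := by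
    simpa using (((hasDerivAt_id s).sub_const a).const_mul v).const_add r
  exact (this.smul_const (EuclideanSpace.single i (1:ℝ))).deriv

theorem exists_near (hR : P.Regular C₀ c₀ G) {t : ℝ} (ht : t ∈ Icc 0 P.T) {x : E N}
    (hx : x ∈ junction N) {ε : ℝ} (hε : 0 < ε) :
    ∃ y, Traj P.p t P.T y ∧ y t = x ∧ P.cost t y < P.value x t + ε := by
  have hne : (P.cost t '' {y | P.Admissible t x y}).Nonempty := by
    obtain ⟨i, hi⟩ := mem_junction_iff.1 hx
    have h := traj_pt hR.one_lt_p ht.2 i (x i) 0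
      (fun s _ => by simpa using (mem_edge_iff.1 hi).1)
    refine ⟨_, _, admissible_iff.2 ⟨h, ?_⟩, rfl⟩
    simp [← eq_pt_of_mem_edge hi]
  obtain ⟨_, ⟨y, hy, rfl⟩, hlt⟩ := exists_lt_of_csInf_lt hne
    (show sInf (P.cost t '' {y | P.Admissible t x y}) < P.value x t + ε from
      lt_add_of_pos_right _ hε)
  exact ⟨y, (admissible_iff.1 hy).1, (admissible_iff.1 hy).2, hlt⟩

/-- Dynamic programming: it is never better to follow an arbitrary trajectory until time `τ`. -/
theorem value_le_integral_add (hR : P.Regular C₀ c₀ G) {t τ : ℝ} (ht : 0 ≤ t) (htτ : t ≤ τ)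
    (hτ : τ ≤ P.T) (hy : Traj P.p t τ y) :
    P.value (y t) t ≤ (∫ s in t..τ, P.along y s) + P.value (y τ) τ := by
  have hτ' : τ ∈ Icc 0 P.T := ⟨ht.trans htτ, hτ⟩
  refine le_of_forall_pos_le_add fun ε hε => ?_
  obtain ⟨z, hz, hz0, hz1⟩ := hR.exists_near hτ' (hy.mem τ ⟨htτ, le_rfl⟩) hε
  set q : ℝ → E N := fun s => if s ≤ τ then y s else z s with hq
  have hqT : Traj P.p t P.T q := hy.concat hz hR.one_lt_p htτ hτ hz0.symm
  have h1 := hR.value_le_cost ⟨ht, htτ.trans hτ⟩ hqT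
  have hqt : q t = y t := by simp [hq, htτ]
  have hqT' : q P.T = z P.T := by
    rcases hτ.eq_or_lt with h | h
    · simp only [hq]; rw [← h]; simp [hz0]
    · simp [hq, not_le.2 h]
  have hi1 : IntervalIntegrable (P.along q) volume t τ :=
    hR.integrable (hqT.mono le_rfl htτ hτ) ht htτ hτ
  have hi2 : IntervalIntegrable (P.along q) volume τ P.T :=
    hR.integrable (hqT.mono htτ hτ le_rfl) hτ'.1 hτ le_rfl
  -- Open interval: at the gluing time the derivative of `q` need not be that of `y`.
  have e1 : ∫ s in t..τ, P.along q s = ∫ s in t..τ, P.along y s := by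
    rw [intervalIntegral.integral_of_le htτ, intervalIntegral.integral_of_le htτ,
      integral_Ioc_eq_integral_Ioo, integral_Ioc_eq_integral_Ioo]
    refine setIntegral_congr_fun measurableSet_Ioo fun s hs => ?_
    have e : q s = y s := if_pos hs.2.le
    have e' : deriv q s = deriv y s := deriv_ite_of_lt y z hs.2
    simp only [along, e, e']
  have e2 : ∫ s in τ..P.T, P.along q s = ∫ s in τ..P.T, P.along z s := by
    rw [intervalIntegral.integral_of_le hτ, intervalIntegral.integral_of_le hτ]
    refine setIntegral_congr_fun measurableSet_Ioc fun s hs => ?_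
    have e : q s = z s := if_neg (not_le.2 hs.1)
    have e' : deriv q s = deriv z s := deriv_ite_of_gt y z hs.1
    simp only [along, e, e']
  rw [hqt, cost_eq, ← intervalIntegral.integral_add_adjacent_intervals hi1 hi2, e1, e2, hqT'] at h1
  rw [cost_eq] at hz1
  linarith

theorem integral_add_value_le (hR : P.Regular C₀ c₀ G) {t τ : ℝ} (ht : 0 ≤ t) (htτ : t ≤ τ)
    (hτ : τ ≤ P.T) (hy : Traj P.p t P.T y) :
    (∫ s in t..τ, P.along y s) + P.value (y τ) τ ≤ P.cost t y := by
  have h1 := hR.value_le_cost ⟨ht.trans htτ, hτ⟩ (hy.mono htτ hτ le_rfl)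
  rw [cost_eq] at h1 ⊢
  rw [← intervalIntegral.integral_add_adjacent_intervals
    (hR.integrable (hy.mono le_rfl htτ hτ) ht htτ hτ)
    (hR.integrable (hy.mono htτ hτ le_rfl) (ht.trans htτ) hτ le_rfl)]
  linarith

theorem value_final (hR : P.Regular C₀ c₀ G) {x : E N} (hx : x ∈ junction N) :
    P.value x P.T = P.terminalCost x := by
  have hT : P.T ∈ Icc 0 P.T := ⟨hR.standing.T_pos.le, le_rfl⟩
  have hc : ∀ y, y P.T = x → P.cost P.T y = P.terminalCost x := fun y h => by
    rw [cost_eq, intervalIntegral.integral_same, zero_add, h]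
  refine le_antisymm (le_of_forall_pos_le_add fun ε hε => ?_)
    (le_of_forall_pos_le_add fun ε hε => ?_)
  · obtain ⟨y, hy, hy0, hy1⟩ := hR.exists_near hT hx hε
    have := hR.value_le_cost hT hy
    rw [hc y hy0, hy0] at this
    linarith
  · obtain ⟨y, hy, hy0, hy1⟩ := hR.exists_near hT hx hε
    rw [hc y hy0] at hy1
    exact hy1.le

/-- Upper bound on the cost of moving along an edge at a velocity at most one. -/
theorem value_pt_le (hR : P.Regular C₀ c₀ G) (hB : P.Bounds R C₀ c₀ K) {t τ : ℝ} (ht : 0 ≤ t)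
    (htτ : t ≤ τ) (hτ : τ ≤ P.T) (i : Fin N) {r v : ℝ} (hv : |v| ≤ 1)
    (h : ∀ s ∈ Icc t τ, r + v * (s - t) ∈ Icc 0 R) :
    P.value (pt i r) t ≤ 2 * K * (τ - t) + P.value (pt i (r + v * (τ - t))) τ := by
  set q : ℝ → E N := fun s => pt i (r + v * (s - t)) with hq
  have hT : Traj P.p t τ q := traj_pt hR.one_lt_p htτ i r v fun s hs => (h s hs).1
  have h1 := hR.value_le_integral_add ht htτ hτ hT
  have h2 : ∫ s in t..τ, P.along q s ≤ ∫ _s in t..τ, 2 * K := by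
    refine intervalIntegral_mono_of_ae_Ioo htτ (hR.integrable hT ht htτ hτ)
      intervalIntegrable_const ?_
    filter_upwards [hT.ae_differentiableAt htτ] with s hs hs'
    have hsI := h s (Ioo_subset_Icc_self hs')
    refine (hB.along_le hT ht hτ hs' (hs hs') ?_).trans ?_
    · simp only [hq]; rw [norm_pt i hsI.1]; exact hsI.2
    · rw [hq, deriv_pt, norm_pt_abs]
      have := Real.rpow_le_one (abs_nonneg v) hv (show 0 ≤ P.p by linarith [hR.one_lt_p])
      have := mul_le_mul_of_nonneg_left (show |v| ^ P.p + 1 ≤ 2 by linarith) hB.K_nonneg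
      linarith
  rw [intervalIntegral.integral_const, smul_eq_mul] at h2
  simp only [hq] at h1
  rw [sub_self, mul_zero, add_zero] at h1
  linarith

theorem exists_abs_value_le (hR : P.Regular C₀ c₀ G) (r : ℝ) :
    ∃ M, ∀ x ∈ junction N, ‖x‖ ≤ r → ∀ t ∈ Icc 0 P.T, |P.value x t| ≤ M := by
  obtain ⟨K, hK⟩ := hR.bounds (|r| + 1) (by positivity)
  refine ⟨2 * K * P.T + |c₀| * P.T + G, fun x hx hxr t ht => ?_⟩
  have hT := hR.standing.T_pos
  have hG : 0 ≤ G := (abs_nonneg _).trans (hR.terminal x hx)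
  have hK0 := hK.K_nonneg
  have h0 : 0 ≤ |c₀| * P.T := by positivity
  rw [abs_le]
  constructor
  · refine le_of_forall_pos_le_add fun ε hε => ?_
    obtain ⟨y, hy, hy0, hy1⟩ := hR.exists_near ht hx hε
    have := hR.le_cost ht hy
    have h0' : 0 ≤ ∫ s in t..P.T, ‖deriv y s‖ ^ P.p :=
      intervalIntegral.integral_nonneg ht.2 fun s _ => Real.rpow_nonneg (norm_nonneg _) _
    have := mul_nonneg hR.C_pos.le h0'
    have : 0 ≤ 2 * K * P.T := by positivity
    linarith
  · obtain ⟨i, hi⟩ := mem_junction_iff.1 hx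
    have h1 := hR.value_pt_le hK ht.1 ht.2 le_rfl i (r := x i) (v := 0) (by simp) fun s _ => by
      rw [zero_mul, add_zero, ← norm_of_mem_edge hi]
      exact ⟨norm_nonneg _, by linarith [le_abs_self r]⟩
    rw [zero_mul, add_zero, ← eq_pt_of_mem_edge hi, hR.value_final hx] at h1
    have h2 : 2 * K * (P.T - t) ≤ 2 * K * P.T :=
      mul_le_mul_of_nonneg_left (by linarith [ht.1]) (by positivity)
    linarith [(abs_le.1 (hR.terminal x hx)).2]

/-- Near-optimal trajectories stay in a bounded set and have bounded energy. -/
theorem exists_near_bounded (hR : P.Regular C₀ c₀ G) (r : ℝ) :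
    ∃ R' A, r ≤ R' ∧ 0 ≤ A ∧ ∀ t ∈ Icc 0 P.T, ∀ x ∈ junction N, ‖x‖ ≤ r → ∀ ε, 0 < ε → ε ≤ 1 →
      ∃ y, Traj P.p t P.T y ∧ y t = x ∧ P.cost t y < P.value x t + ε ∧
        (∀ s ∈ Icc t P.T, ‖y s‖ ≤ R') ∧ ∫ s in t..P.T, ‖deriv y s‖ ^ P.p ≤ A := by
  obtain ⟨M, hM⟩ := hR.exists_abs_value_le r
  have hC := hR.C_pos
  have hT := hR.standing.T_pos
  -- Solve the coercive lower bound on the cost for the energy, the cost being at most `M + 1`.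
  -- Displacement is then at most `P.T + A`, since `‖y'‖ ≤ 1 + ‖y'‖^p`.
  set A := (|M| + 1 + |c₀| * P.T + |G|) / C₀ with hA
  have hA0 : 0 ≤ A := by positivity
  refine ⟨r + P.T + A, A, by linarith, hA0, fun t ht x hx hxr ε hε hε1 => ?_⟩
  obtain ⟨y, hy, hy0, hy1⟩ := hR.exists_near ht hx hε
  have hen : ∫ s in t..P.T, ‖deriv y s‖ ^ P.p ≤ A := by
    rw [hA, le_div_iff₀ hC]
    have h1 := hR.le_cost ht hy
    have h2 := (abs_le.1 (hM x hx hxr t ht)).2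
    linarith [le_abs_self M, le_abs_self G]
  refine ⟨y, hy, hy0, hy1, fun s hs => ?_, hen⟩
  have h1 := (hy.mono le_rfl hs.1 hs.2).norm_sub_le_rpow hR.one_lt_p hs.1
  have h2 : ∫ σ in t..s, ‖deriv y σ‖ ^ P.p ≤ ∫ σ in t..P.T, ‖deriv y σ‖ ^ P.p := by
    refine intervalIntegral.integral_mono_interval le_rfl hs.1 hs.2
      (Eventually.of_forall fun σ => Real.rpow_nonneg (norm_nonneg _) _)
      (hy.intervalIntegrable_rpow hR.one_lt_p ht.2)
  have h3 : ‖y s‖ ≤ ‖y s - y t‖ + ‖y t‖ := by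
    simpa using norm_add_le (y s - y t) (y t)
  rw [hy0] at h3
  rw [hy0] at h1
  linarith [hs.1, hs.2, ht.1]

end Regular

end Problem

end JunctionControl

namespace JunctionControl

variable {N : ℕ} {P : Problem N} {R C₀ c₀ G K a b : ℝ} {y z : ℝ → E N} {w : ℝ → ℝ}

/-! ### Perturbed trajectories -/

/-- Puts the derivative of a displaced curve in `L^p`; no differentiability of `z` is needed, since
only its increments near `s` enter. -/
theorem norm_deriv_le_of_dist_le {C s : ℝ} (hC : 0 ≤ C) (hy : DifferentiableAt ℝ y s)
    (hw : LipschitzWith 1 w)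
    (h : ∀ s r, dist (z s) (z r) ≤ C * (dist (y s) (y r) + dist (w s) (w r))) :
    ‖deriv z s‖ ≤ C * (‖deriv y s‖ + 1) := by
  have key : ∀ ε : ℝ, 0 < ε → ‖deriv z s‖ ≤ C * (‖deriv y s‖ + ε + 1) := by
    intro ε hε
    refine norm_deriv_le_of_lip' (by positivity) ?_
    filter_upwards [(hasDerivAt_iff_isLittleO.1 hy.hasDerivAt).def hε] with r hr
    have h1 := h r s
    have h2 := hw.dist_le_mul r s
    rw [NNReal.coe_one, one_mul, dist_eq_norm r s] at h2
    have h3 : dist (y r) (y s) ≤ (‖deriv y s‖ + ε) * ‖r - s‖ := by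
      rw [dist_eq_norm]
      calc ‖y r - y s‖ = ‖(y r - y s - (r - s) • deriv y s) + (r - s) • deriv y s‖ := by
            rw [sub_add_cancel]
        _ ≤ ε * ‖r - s‖ + ‖r - s‖ * ‖deriv y s‖ :=
            (norm_add_le _ _).trans (add_le_add hr (norm_smul _ _).le)
        _ = _ := by ring
    rw [← dist_eq_norm]
    calc dist (z r) (z s) ≤ C * (dist (y r) (y s) + dist (w r) (w s)) := h1
      _ ≤ C * ((‖deriv y s‖ + ε) * ‖r - s‖ + ‖r - s‖) :=
          mul_le_mul_of_nonneg_left (add_le_add h3 h2) hC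
      _ = _ := by ring
  have hlim : Tendsto (fun ε : ℝ => C * (‖deriv y s‖ + ε + 1)) (𝓝[>] 0)
      (𝓝 (C * (‖deriv y s‖ + 0 + 1))) := by
    refine Tendsto.mono_left (Continuous.tendsto ?_ _) nhdsWithin_le_nhds
    fun_prop
  rw [add_zero] at hlim
  exact ge_of_tendsto hlim (eventually_mem_nhdsWithin.mono fun ε hε => key ε hε)

theorem Traj.of_dist_le {p C : ℝ} (hy : Traj p a b y) (hab : a ≤ b) (hC : 0 ≤ C)
    (hw : LipschitzWith 1 w)
    (h : ∀ s r, dist (z s) (z r) ≤ C * (dist (y s) (y r) + dist (w s) (w r)))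
    (hmem : ∀ s ∈ Icc a b, z s ∈ junction N) : Traj p a b z where
  mem := hmem
  absCont := hy.absCont.of_dist_le hw.lipschitzOnWith.absolutelyContinuousOnInterval h
  memLp := by
    have h1 : MemLp (fun s => C * (‖deriv y s‖ + 1)) (ENNReal.ofReal p)
        (volume.restrict (Ioo a b)) := (hy.memLp.norm.add (memLp_const 1)).const_mul C
    refine h1.mono (measurable_deriv z).aestronglyMeasurable ?_
    rw [ae_restrict_iff' measurableSet_Ioo]
    filter_upwards [hy.ae_differentiableAt hab] with s hs hs'
    rw [Real.norm_of_nonneg (by positivity)]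
    exact norm_deriv_le_of_dist_le hC (hs hs') hw h

namespace Problem

/-- The cost per unit of time of changing velocities at most `M` by one unit. -/
def slowCost (P : Problem N) (c₀ K M : ℝ) : ℝ := K * ((M + 1) ^ P.p + 1) + |c₀|

namespace Bounds

theorem le_slowCost (hB : P.Bounds R C₀ c₀ K) {M : ℝ} (hM : 0 ≤ M) :
    K ≤ P.slowCost c₀ K M + c₀ := by
  have h1 : 0 ≤ (M + 1) ^ P.p := Real.rpow_nonneg (by linarith) _
  have := mul_nonneg hB.K_nonneg h1
  unfold slowCost
  linarith [neg_abs_le c₀]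

theorem slowCost_nonneg (hB : P.Bounds R C₀ c₀ K) {M : ℝ} (hM : 0 ≤ M) :
    0 ≤ P.slowCost c₀ K M := by
  have h1 : 0 ≤ (M + 1) ^ P.p := Real.rpow_nonneg (by linarith) _
  have := mul_nonneg hB.K_nonneg h1
  unfold slowCost
  linarith [abs_nonneg c₀, hB.K_nonneg]

/-- Here `d` is the slope of the gap and `σ` the direction of displacement, `-1` inward and `1`
outward. With `d = 0` only the position changes, and the Lipschitz bound suffices. With `d = -1` the
two costs are estimated separately, and `slowCost` exceeds their difference because the perturbed
speed is at most `M + 1`. -/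
theorem ell_perturb_le (hB : P.Bounds R C₀ c₀ K) {M D y₁ y₂ v d s : ℝ} {i : Fin N}
    (h1 : y₁ ∈ Icc 0 R) (h2 : y₂ ∈ Icc 0 R) (hD : |y₁ - y₂| ≤ D) (hs : s ∈ Icc 0 P.T)
    (hd : d = 0 ∨ (d = -1 ∧ |v| ≤ M)) {σ : ℝ} (hσ : |σ| = 1) :
    P.ell i y₁ (v + σ * d) s ≤
      P.ell i y₂ v s - P.slowCost c₀ K M * d + D * (K * (|v| ^ P.p + 1)) := by
  have hv := Real.rpow_nonneg (abs_nonneg v) P.p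
  have hKv : 0 ≤ K * (|v| ^ P.p + 1) := mul_nonneg hB.K_nonneg (by linarith)
  rcases hd with rfl | ⟨rfl, hv'⟩
  · have h := hB.lip i y₁ h1 y₂ h2 v s hs
    have h' := mul_le_mul_of_nonneg_left hD hKv
    simp only [mul_zero, add_zero, sub_zero]
    linarith
  · have hM : 0 ≤ M := (abs_nonneg v).trans hv'
    have h := hB.upper i y₁ h1 (v + σ * -1) s hs
    have h3 : |v + σ * -1| ≤ M + 1 := by
      refine (abs_add_le _ _).trans ?_
      rw [abs_mul, hσ]; simpa using hv'
    have h4 : |v + σ * -1| ^ P.p ≤ (M + 1) ^ P.p :=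
      Real.rpow_le_rpow (abs_nonneg _) h3 (by linarith [hB.one_lt_p])
    have h5 := mul_le_mul_of_nonneg_left (add_le_add h4 (le_refl (1 : ℝ))) hB.K_nonneg
    have h6 := hB.lower i y₂ h2.1 v s hs
    have h7 := mul_nonneg hB.C_pos.le hv
    have h8 : 0 ≤ D * (K * (|v| ^ P.p + 1)) := mul_nonneg ((abs_nonneg _).trans hD) hKv
    have h9 := neg_abs_le c₀
    unfold slowCost
    linarith

/-- No continuity of the terminal cost is needed inward: landing on the vertex can only lower the
cost below `g_i(0)`. -/
theorem terminalCost_shrink_le (hB : P.Bounds R C₀ c₀ K) {x : E N} (hx : x ∈ junction N)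
    (hxR : ‖x‖ ≤ R) {ω D : ℝ} (hω : 0 ≤ ω) (hωD : ω ≤ D) :
    P.terminalCost (shrink ω x) ≤ P.terminalCost x + K * D := by
  have hKD : 0 ≤ K * D := mul_nonneg hB.K_nonneg (hω.trans hωD)
  rcases eq_or_ne x 0 with rfl | h0
  · have : shrink ω (0 : E N) = 0 := by
      rw [← norm_le_zero_iff]; simpa using norm_shrink_le hω hx
    rw [this]; linarith
  · obtain ⟨i, hi⟩ := mem_junction_iff.1 hx
    have hpos := pos_of_mem_edge hi h0
    rw [norm_of_mem_edge hi] at hxR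
    have hsh : shrink ω x = pt i (max (x i - ω) 0) := by
      conv_lhs => rw [eq_pt_of_mem_edge hi, shrink_pt i hω]
    rw [terminalCost_of_mem P hi h0, hsh]
    rcases le_or_gt (x i) ω with h | h
    · rw [max_eq_right (by linarith), pt_zero]
      have h1 := P.terminalCost_zero_le i
      have h2 := hB.g_lip i 0 ⟨le_rfl, hpos.le.trans hxR⟩ (x i) ⟨hpos.le, hxR⟩
      rw [zero_sub, abs_neg, abs_of_pos hpos] at h2
      have h3 := mul_le_mul_of_nonneg_left (h.trans hωD) hB.K_nonneg
      linarith
    · rw [max_eq_left (by linarith)]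
      have hne : pt i (x i - ω) ≠ 0 := by
        rw [← norm_pos_iff, norm_pt i (by linarith)]; linarith
      rw [terminalCost_of_mem P (pt_mem_edge i (by linarith)) hne, pt_apply_self]
      have h2 := hB.g_lip i (x i - ω) ⟨by linarith, by linarith⟩ (x i) ⟨hpos.le, hxR⟩
      rw [sub_sub_cancel_left, abs_neg, abs_of_nonneg hω] at h2
      have h3 := mul_le_mul_of_nonneg_left hωD hB.K_nonneg
      linarith

end Bounds

namespace Regular

/-- The term `-S * w'` integrates to `S * (D - w b) ≤ S * D`: closing the gap costs `S` per unit
closed, however the slow times are distributed. -/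
theorem integral_le_of_perturb (hR : P.Regular C₀ c₀ G) (hB : P.Bounds R C₀ c₀ K)
    (hy : Traj P.p a b y) (hz : Traj P.p a b z) (ha : 0 ≤ a) (hab : a ≤ b) (hb : b ≤ P.T)
    (hw : LipschitzWith 1 w) {D S A : ℝ} (hwa : w a = D) (hwb : 0 ≤ w b) (hD : 0 ≤ D)
    (hS : 0 ≤ S) (hA : ∫ s in a..b, ‖deriv y s‖ ^ P.p ≤ A)
    (h : ∀ᵐ s, s ∈ Ioo a b →
      P.along z s ≤ P.along y s - S * deriv w s + D * (K * (‖deriv y s‖ ^ P.p + 1))) :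
    ∫ s in a..b, P.along z s ≤ (∫ s in a..b, P.along y s) + D * (S + K * (A + P.T)) := by
  have hI := hy.intervalIntegrable_rpow hR.one_lt_p hab
  have hwac : AbsolutelyContinuousOnInterval w a b :=
    hw.lipschitzOnWith.absolutelyContinuousOnInterval
  have hi1 := hR.integrable hy ha hab hb
  have hi2 := hwac.intervalIntegrable_deriv.const_mul S
  have hi3 : IntervalIntegrable (fun s => D * (K * (‖deriv y s‖ ^ P.p + 1))) volume a b :=
    ((hI.add intervalIntegrable_const).const_mul K).const_mul D
  have h1 := intervalIntegral_mono_of_ae_Ioo hab (hR.integrable hz ha hab hb)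
    ((hi1.sub hi2).add hi3) h
  rw [intervalIntegral.integral_add (hi1.sub hi2) hi3, intervalIntegral.integral_sub hi1 hi2,
    intervalIntegral.integral_const_mul, hwac.integral_deriv_eq_sub,
    intervalIntegral.integral_const_mul, intervalIntegral.integral_const_mul,
    intervalIntegral.integral_add hI intervalIntegrable_const, intervalIntegral.integral_const,
    smul_eq_mul, mul_one, hwa] at h1
  have h2 : D * (K * ((∫ s in a..b, ‖deriv y s‖ ^ P.p) + (b - a))) ≤ D * (K * (A + P.T)) :=
    mul_le_mul_of_nonneg_left (mul_le_mul_of_nonneg_left (by linarith) hB.K_nonneg) hD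
  have h3 := mul_nonneg hS hwb
  linarith

/-- Moving a whole trajectory towards the vertex. -/
theorem value_shrink_le_cost (hR : P.Regular C₀ c₀ G) (hB : P.Bounds R C₀ c₀ K) {M D t A : ℝ}
    (hM : 0 ≤ M) (hKM : K ≤ C₀ * M ^ P.p + c₀) (ht : t ∈ Icc 0 P.T) (hy : Traj P.p t P.T y)
    (hyR : ∀ s ∈ Icc t P.T, ‖y s‖ ≤ R) (hA : ∫ s in t..P.T, ‖deriv y s‖ ^ P.p ≤ A) (hD : 0 ≤ D) :
    P.value (shrink D (y t)) t ≤
      P.cost t y + D * (P.slowCost c₀ K M + K * (A + P.T) + K) := by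
  have hmeas : MeasurableSet {s | ‖deriv y s‖ ≤ M} :=
    measurableSet_le (measurable_deriv y).norm measurable_const
  obtain ⟨w, hw, hwt, hw0, hwD, -, hwd⟩ := exists_lipschitz_decay hmeas t hD
  set z : ℝ → E N := fun s => shrink (w s) (y s) with hzdef
  have hS := hB.slowCost_nonneg hM
  have hz : Traj P.p t P.T z := hy.of_dist_le ht.2 (Nat.cast_nonneg N) hw
    (fun s r => dist_shrink_le _ _ _ _) (fun s hs => shrink_mem (hw0 s) (hy.mem s hs))
  have h1 := hR.integral_le_of_perturb hB hy hz ht.1 ht.2 le_rfl hw hwt (hw0 _) hD hS hA (by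
    filter_upwards [hy.ae_differentiableAt ht.2, hz.ae_differentiableAt ht.2, hwd]
      with s hsy hsz hsw hs
    have hsI := Ioo_subset_Icc_self hs
    have hsT : s ∈ Icc 0 P.T := ⟨ht.1.trans hs.1.le, hs.2.le⟩
    have hyd := hsy hs
    have hzd := hsz hs
    have hEn : 0 ≤ D * (K * (‖deriv y s‖ ^ P.p + 1)) :=
      mul_nonneg hD (mul_nonneg hB.K_nonneg
        (by linarith [Real.rpow_nonneg (norm_nonneg (deriv y s)) P.p]))
    -- A zero slope is recorded with its cause, gap already closed or fast motion, since the case of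
    -- a curve resting at the vertex depends on it.
    obtain ⟨d, hd, hdc⟩ : ∃ d, HasDerivAt w d s ∧
        ((d = 0 ∧ (w s = 0 ∨ M < ‖deriv y s‖)) ∨ (d = -1 ∧ ‖deriv y s‖ ≤ M)) := by
      rcases (hw0 s).eq_or_lt with h | h
      · exact ⟨0, hsw.2 h.symm, Or.inl ⟨rfl, Or.inl h.symm⟩⟩
      · refine ⟨_, hsw.1 h, ?_⟩
        rcases le_or_gt ‖deriv y s‖ M with h' | h'
        · exact Or.inr ⟨by rw [indicator_of_mem (by exact h')]; rfl, h'⟩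
        · exact Or.inl ⟨by rw [indicator_of_notMem (by exact not_le.2 h')]; simp, Or.inr h'⟩
    have hd0 : d ≤ 0 := by rcases hdc with ⟨rfl, -⟩ | ⟨rfl, -⟩ <;> norm_num
    have hSd : 0 ≤ -(P.slowCost c₀ K M * d) := by
      rw [← mul_neg]; exact mul_nonneg hS (by linarith)
    rw [hd.deriv]
    rcases eq_or_ne (y s) 0 with h0 | h0
    · have hz0 : z s = 0 := by
        have h : ‖z s‖ ≤ ‖y s‖ := norm_shrink_le (hw0 s) (hy.mem s hsI)
        rwa [h0, norm_zero, norm_le_zero_iff] at h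
      simp only [along, h0, hz0, runningCost_zero]
      linarith
    · obtain ⟨i, hi⟩ := mem_junction_iff.1 (hy.mem s hsI)
      have hpos := pos_of_mem_edge hi h0
      have hyR' := hyR s hsI
      rw [norm_of_mem_edge hi] at hyR'
      have hzs : z s = pt i (max (y s i - w s) 0) := by
        show shrink (w s) (y s) = _
        conv_lhs => rw [eq_pt_of_mem_edge hi, shrink_pt i (hw0 s)]
      have hyn := hy.norm_deriv_eq hs hyd hi
      have hya : P.along y s = P.ell i (y s i) (deriv y s i) s := runningCost_of_mem P hi h0 _ _
      -- If `y s i ≤ w s`, the displaced curve rests at the vertex. A closed gap is impossible as `0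
      -- < y s i`; in fast motion `y` pays at least `C₀ * M^p + c₀ ≥ K`; in slow motion the closing
      -- gap contributes `slowCost`, which suffices.
      rcases le_or_gt (y s i) (w s) with h | h
      · rw [max_eq_right (by linarith), pt_zero] at hzs
        have hza : P.along z s = P.ellZero s := by rw [along, hzs, runningCost_zero]
        have hu := hB.upper_zero s hsT
        have hl := hB.lower i (y s i) hpos.le (deriv y s i) s hsT
        rw [hza, hya]
        rw [hyn] at hdc hEn ⊢
        rcases hdc with ⟨rfl, h' | h'⟩ | ⟨rfl, h'⟩
        · linarith
        · have h2 : M ^ P.p ≤ |deriv y s i| ^ P.p :=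
            Real.rpow_le_rpow hM h'.le (by linarith [hR.one_lt_p])
          have h3 := mul_le_mul_of_nonneg_left h2 hB.C_pos.le
          linarith
        · have h2 := hB.le_slowCost hM
          have h3 := mul_nonneg hB.C_pos.le (Real.rpow_nonneg (abs_nonneg (deriv y s i)) P.p)
          linarith
      · rw [max_eq_left (by linarith)] at hzs
        have hz0 : z s ≠ 0 := by
          rw [hzs, ← norm_pos_iff, norm_pt i (by linarith)]; linarith
        have hzi : z s ∈ edge i := by rw [hzs]; exact pt_mem_edge i (by linarith)
        have hyi := hasDerivAt_coord hyd i
        have hder : HasDerivAt (fun r => z r i) (deriv y s i - d) s := by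
          refine (hyi.sub hd).congr_of_eventuallyEq ?_
          have hc := (hyi.continuousAt.sub hd.continuousAt).eventually
            (lt_mem_nhds (show (0 : ℝ) < y s i - w s by linarith))
          filter_upwards [hc] with r hr
          exact max_eq_left hr.le
        have hza : P.along z s = P.ell i (y s i - w s) (deriv y s i + -1 * d) s := by
          rw [along, runningCost_of_mem P hzi hz0, (hasDerivAt_coord hzd i).unique hder, hzs,
            pt_apply_self]
          ring_nf
        rw [hza, hya]
        rw [hyn] at hdc ⊢
        refine hB.ell_perturb_le ⟨by linarith, by linarith [hw0 s]⟩ ⟨hpos.le, hyR'⟩ ?_ hsT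
          (hdc.imp And.left id) (by norm_num)
        rw [sub_sub_cancel_left, abs_neg, abs_of_nonneg (hw0 s)]
        exact hwD s hs.1.le)
  have h2 := hB.terminalCost_shrink_le (hy.mem P.T ⟨ht.2, le_rfl⟩) (hyR P.T ⟨ht.2, le_rfl⟩)
    (hw0 P.T) (hwD P.T ht.2)
  have h3 := hR.value_le_cost ht hz
  rw [cost_eq] at h3 ⊢
  have hzt : z t = shrink D (y t) := by simp only [hzdef, hwt]
  rw [hzt] at h3
  have hzT : z P.T = shrink (w P.T) (y P.T) := rfl
  rw [hzT] at h3
  linarith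

/-- Moving a trajectory outward, until it reaches the vertex or the gap vanishes. -/
theorem exists_expand (hR : P.Regular C₀ c₀ G) (hB : P.Bounds R C₀ c₀ K) {M h t A r : ℝ}
    {i : Fin N} (hM : 0 < M) (ht : t ∈ Icc 0 P.T) (hy : Traj P.p t P.T y) (hr : 0 ≤ r)
    (hyt : y t = pt i r) (hh : 0 ≤ h) (hyR : ∀ s ∈ Icc t P.T, ‖y s‖ + h ≤ R)
    (hA : ∫ s in t..P.T, ‖deriv y s‖ ^ P.p ≤ A) :
    ∃ τ ∈ Icc t P.T, ∃ ρ ∈ Icc 0 h, y τ ∈ edge i ∧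
      P.value (pt i (r + h)) t ≤ (∫ s in t..τ, P.along y s)
        + h * (P.slowCost c₀ K M + K * (A + P.T)) + P.value (y τ + pt i ρ) τ ∧
      (ρ = 0 ∨ y τ = 0 ∨ τ = P.T) ∧ (ρ = 0 ∨ M ^ P.p * (τ - t - h) ≤ A) := by
  have hmeas : MeasurableSet {s | ‖deriv y s‖ ≤ M} :=
    measurableSet_le (measurable_deriv y).norm measurable_const
  obtain ⟨w, hw, hwt, hw0, hwD, hwi, hwd⟩ := exists_lipschitz_decay hmeas t hh
  have hS := hB.slowCost_nonneg hM.le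
  have hcont := hy.continuousOn ht.2
  -- The product vanishes when `y` has no component on edge `i`, when the gap is closed, or at the
  -- horizon; the last factor makes the set nonempty.
  obtain ⟨τ, ⟨hτI, hτ0⟩, hτmin⟩ : ∃ τ, IsLeast
      (Icc t P.T ∩ (fun s => y s i * (w s * (P.T - s))) ⁻¹' {0}) τ := by
    refine IsCompact.exists_isLeast ?_ ⟨P.T, ⟨ht.2, le_rfl⟩, by simp⟩
    refine isCompact_Icc.of_isClosed_subset ?_ inter_subset_left
    refine ContinuousOn.preimage_isClosed_of_isClosed ?_ isClosed_Icc isClosed_singleton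
    exact ((PiLp.continuous_apply 2 _ i).comp_continuousOn hcont).mul
      (hw.continuous.continuousOn.mul (by fun_prop))
  have hbefore : ∀ s ∈ Ico t τ, 0 < y s i ∧ 0 < w s := by
    intro s hs
    have hsI : s ∈ Icc t P.T := ⟨hs.1, hs.2.le.trans hτI.2⟩
    have hne : y s i * (w s * (P.T - s)) ≠ 0 := fun h0 =>
      absurd (hτmin ⟨hsI, h0⟩) (not_le.2 hs.2)
    have h1 := left_ne_zero_of_mul hne
    have h2 := left_ne_zero_of_mul (right_ne_zero_of_mul hne)
    exact ⟨lt_of_le_of_ne (nonneg_of_mem (hy.mem s hsI) i) h1.symm,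
      lt_of_le_of_ne (hw0 s) h2.symm⟩
  -- Positivity of the coordinate keeps `y` on edge `i` before `τ`, and closedness of the edge
  -- includes `τ`. If `τ = t` there is no earlier time, and the starting point is used.
  have hedge : ∀ s ∈ Icc t τ, y s ∈ edge i := by
    rcases hτI.1.eq_or_lt with h | h
    · intro s hs
      rw [← h, Icc_self, mem_singleton_iff] at hs
      rw [hs, hyt]; exact pt_mem_edge i hr
    · have h1 : MapsTo y (Ico t τ) (edge i) := fun s hs =>
        mem_edge_of_pos (hy.mem s ⟨hs.1, hs.2.le.trans hτI.2⟩) (hbefore s hs).1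
      have h2 := h1.closure_of_continuousOn (by
        rw [closure_Ico h.ne]; exact hcont.mono (Icc_subset_Icc_right hτI.2))
      rwa [closure_Ico h.ne, (isClosed_edge i).closure_eq] at h2
  have hyτ := hy.mono le_rfl hτI.1 hτI.2
  set z : ℝ → E N := fun s => y s + pt i (w s) with hzdef
  have hzs : ∀ s ∈ Icc t τ, z s = pt i (y s i + w s) := fun s hs => by
    simp only [hzdef]
    conv_lhs => rw [eq_pt_of_mem_edge (hedge s hs)]
    rw [pt_add]
  have hz : Traj P.p t τ z := by
    refine hyτ.of_dist_le hτI.1 zero_le_one hw (fun s r => ?_) (fun s hs => ?_)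
    · simp only [hzdef, one_mul]
      refine (dist_add_add_le _ _ _ _).trans (add_le_add le_rfl ?_)
      rw [dist_eq_norm, pt_sub, norm_pt_abs, Real.dist_eq]
    · rw [hzs s hs]
      exact pt_mem i (add_nonneg (mem_edge_iff.1 (hedge s hs)).1 (hw0 s))
  have hI := hy.intervalIntegrable_rpow hR.one_lt_p ht.2
  have hAτ : ∫ s in t..τ, ‖deriv y s‖ ^ P.p ≤ A :=
    (intervalIntegral.integral_mono_interval le_rfl hτI.1 hτI.2
      (Eventually.of_forall fun σ => Real.rpow_nonneg (norm_nonneg _) _) hI).trans hA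
  have h1 := hR.integral_le_of_perturb hB hyτ hz ht.1 hτI.1 hτI.2 hw hwt (hw0 _) hh hS hAτ (by
    filter_upwards [hyτ.ae_differentiableAt hτI.1, hz.ae_differentiableAt hτI.1, hwd]
      with s hsy hsz hsw hs
    have hsI := Ioo_subset_Icc_self hs
    have hsT : s ∈ Icc 0 P.T := ⟨ht.1.trans hs.1.le, hs.2.le.trans hτI.2⟩
    have hyd := hsy hs
    obtain ⟨hypos, hwpos⟩ := hbefore s ⟨hs.1.le, hs.2⟩
    have hi := hedge s hsI
    have h0 : y s ≠ 0 := fun h => by rw [h] at hypos; simp at hypos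
    have hyR' := hyR s ⟨hs.1.le, hs.2.le.trans hτI.2⟩
    rw [norm_of_mem_edge hi] at hyR'
    have hwh := hwD s hs.1.le
    obtain ⟨d, hd, hdc⟩ : ∃ d, HasDerivAt w d s ∧ (d = 0 ∨ (d = -1 ∧ ‖deriv y s‖ ≤ M)) := by
      refine ⟨_, hsw.1 hwpos, ?_⟩
      rcases le_or_gt ‖deriv y s‖ M with h' | h'
      · exact Or.inr ⟨by rw [indicator_of_mem (by exact h')]; rfl, h'⟩
      · exact Or.inl (by rw [indicator_of_notMem (by exact not_le.2 h')]; simp)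
    have hyn := hyτ.norm_deriv_eq hs hyd hi
    have hya : P.along y s = P.ell i (y s i) (deriv y s i) s := runningCost_of_mem P hi h0 _ _
    have hz0 : z s ≠ 0 := by
      rw [hzs s hsI, ← norm_pos_iff, norm_pt i (by linarith)]; linarith
    have hzi : z s ∈ edge i := by rw [hzs s hsI]; exact pt_mem_edge i (by linarith)
    have hder : HasDerivAt (fun r => z r i) (deriv y s i + d) s := by
      refine ((hasDerivAt_coord hyd i).add hd).congr_of_eventuallyEq
        (Eventually.of_forall fun r => ?_)
      simp [hzdef, pt]
    have hza : P.along z s = P.ell i (y s i + w s) (deriv y s i + 1 * d) s := by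
      rw [along, runningCost_of_mem P hzi hz0, (hasDerivAt_coord (hsz hs) i).unique hder,
        hzs s hsI, pt_apply_self, one_mul]
    rw [hd.deriv, hza, hya]
    rw [hyn] at hdc ⊢
    refine hB.ell_perturb_le ⟨by linarith, by linarith⟩ ⟨hypos.le, by linarith⟩ ?_ hsT
      hdc (by norm_num)
    rw [add_sub_cancel_left, abs_of_nonneg (hw0 s)]
    exact hwh)
  have h2 := hR.value_le_integral_add ht.1 hτI.1 hτI.2 hz
  have hzt : z t = pt i (r + h) := by
    rw [hzs t ⟨le_rfl, hτI.1⟩, hyt, pt_apply_self, hwt]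
  rw [hzt] at h2
  refine ⟨τ, hτI, w τ, ⟨hw0 τ, hwD τ hτI.1⟩, hedge τ ⟨hτI.1, le_rfl⟩, ?_, ?_, ?_⟩
  · have hzτ : z τ = y τ + pt i (w τ) := rfl
    rw [← hzτ]; linarith
  · have : y τ i * (w τ * (P.T - τ)) = 0 := hτ0
    rcases mul_eq_zero.1 this with h | h
    · refine Or.inr (Or.inl ?_)
      rw [eq_pt_of_mem_edge (hedge τ ⟨hτI.1, le_rfl⟩), h, pt_zero]
    · rcases mul_eq_zero.1 h with h | h
      · exact Or.inl h
      · exact Or.inr (Or.inr (by linarith))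
  · rcases (hw0 τ).eq_or_lt with h' | h'
    · exact Or.inl h'.symm
    · refine Or.inr ?_
      have h3 := hwi τ hτI.1 h'
      have hMp : 0 ≤ M ^ P.p := Real.rpow_nonneg hM.le _
      have hIτ := hyτ.intervalIntegrable_rpow hR.one_lt_p hτI.1
      have hind : IntervalIntegrable ({s | ‖deriv y s‖ ≤ M}.indicator (1 : ℝ → ℝ)) volume t τ := by
        refine (intervalIntegrable_const (c := (1 : ℝ))).mono_fun
          (measurable_one.indicator hmeas).aestronglyMeasurable (Eventually.of_forall fun s => ?_)
        rw [norm_one]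
        exact (norm_indicator_le_norm_self _ _).trans (by simp)
      -- Chebyshev: `M^p - ‖y'‖^p` is at most `M^p` times the indicator of slow times, whose total
      -- length up to `τ` is `h - w τ`.
      have h4 := intervalIntegral.integral_mono_on hτI.1
        ((intervalIntegrable_const (c := M ^ P.p)).sub hIτ) (hind.const_mul (M ^ P.p))
        (fun s _ => by
          have hn := Real.rpow_nonneg (norm_nonneg (deriv y s)) P.p
          by_cases hs : ‖deriv y s‖ ≤ M
          · rw [indicator_of_mem (by exact hs)]; simp only [Pi.one_apply, mul_one]; linarith
          · rw [indicator_of_notMem (by exact hs), mul_zero]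
            have := Real.rpow_le_rpow hM.le (not_le.1 hs).le
              (show 0 ≤ P.p by linarith [hR.one_lt_p])
            linarith)
      rw [intervalIntegral.integral_sub intervalIntegrable_const hIτ,
        intervalIntegral.integral_const_mul, ← h3, intervalIntegral.integral_const,
        smul_eq_mul] at h4
      have h5 := mul_nonneg hMp (hw0 τ)
      linarith

end Regular

end Problem

end JunctionControl

namespace JunctionControl

variable {N : ℕ} {P : Problem N} {C₀ c₀ G : ℝ}

/-! ### Regularity of the value function -/

theorem exists_le_mul_rpow {p c : ℝ} (hp : 1 < p) (hc : 0 < c) (B : ℝ) :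
    ∃ M : ℝ, 0 < M ∧ B ≤ c * M ^ p := by
  refine ⟨max 1 (B / c), lt_max_of_lt_left one_pos, ?_⟩
  have h1 := Real.self_le_rpow_of_one_le (le_max_left 1 (B / c)) hp.le
  have h2 := (le_max_right 1 (B / c)).trans h1
  rwa [div_le_iff₀' hc] at h2

namespace Problem

/-- Both sides are the limit of the terminal cost at the vertex along the open edge `i`. -/
theorem g_zero_eq_of_continuousOn (hP : P.Standing)
    (hg : ContinuousOn P.terminalCost (junction N)) (i : Fin N) :
    P.g i 0 = P.terminalCost 0 := by
  have hpt : ContinuousOn (fun r : ℝ => pt i r) (Ici 0) := by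
    unfold pt; fun_prop
  have h1 : ContinuousOn (fun r => P.terminalCost (pt i r)) (Ici 0) :=
    hg.comp hpt fun r hr => pt_mem i hr
  have h2 := (h1 0 self_mem_Ici).mono_left (nhdsWithin_mono _ Ioi_subset_Ici_self)
  have h3 := (hP.g_cont i 0 self_mem_Ici).mono_left (nhdsWithin_mono _ Ioi_subset_Ici_self)
  simp only [pt_zero] at h2
  refine tendsto_nhds_unique h3 (h2.congr' ?_)
  filter_upwards [self_mem_nhdsWithin] with r (hr : 0 < r)
  have hne : pt i r ≠ 0 := by rw [← norm_pos_iff, norm_pt i hr.le]; exact hr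
  rw [terminalCost_of_mem P (pt_mem_edge i hr.le) hne, pt_apply_self]

namespace Regular

theorem exists_value_shrink_le (hR : P.Regular C₀ c₀ G) (r : ℝ) :
    ∃ C, 0 ≤ C ∧ ∀ t ∈ Icc 0 P.T, ∀ x ∈ junction N, ‖x‖ ≤ r → ∀ D, 0 ≤ D →
      P.value (shrink D x) t ≤ P.value x t + C * D := by
  obtain ⟨R', A, -, hA0, hnear⟩ := hR.exists_near_bounded r
  obtain ⟨K, hK⟩ := hR.bounds (|R'| + 1) (by positivity)
  -- Beyond speed `M`, moving costs at least `K`, hence at least as much as staying at the vertex.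
  obtain ⟨M, hM, hKM⟩ := exists_le_mul_rpow hR.one_lt_p hR.C_pos (K - c₀)
  have hS := hK.slowCost_nonneg hM.le
  have hK0 := hK.K_nonneg
  have hT := hR.standing.T_pos
  refine ⟨P.slowCost c₀ K M + K * (A + P.T) + K, by positivity, fun t ht x hx hxr D hD => ?_⟩
  refine le_of_forall_pos_le_add fun ε hε => ?_
  obtain ⟨y, hy, hyt, hyc, hyR, hyA⟩ := hnear t ht x hx hxr (min ε 1) (by positivity)
    (min_le_right _ _)
  have h := hR.value_shrink_le_cost hK hM.le (by linarith) ht hy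
    (fun s hs => by linarith [hyR s hs, le_abs_self R']) hyA hD
  rw [hyt] at h
  linarith [min_le_left ε 1]

/-- If the value at time `t'` grows at most linearly away from `x`, then little is lost by waiting
at `x` until `t'`. -/
theorem exists_value_le_of_le (hR : P.Regular C₀ c₀ G) (r : ℝ) :
    ∃ R', r ≤ R' ∧ ∀ Λ, 0 ≤ Λ → ∃ C, 0 ≤ C ∧ ∀ t t', 0 ≤ t → t ≤ t' → t' ≤ P.T →
      ∀ x ∈ junction N, ‖x‖ ≤ r →
      (∀ z ∈ junction N, ‖z‖ ≤ R' → P.value x t' ≤ P.value z t' + Λ * ‖z - x‖) →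
      P.value x t' ≤ P.value x t + C * (t' - t) := by
  obtain ⟨R', A, hrR, -, hnear⟩ := hR.exists_near_bounded r
  refine ⟨R', hrR, fun Λ hΛ => ?_⟩
  obtain ⟨C, hC, hY⟩ := exists_mul_le_mul_rpow_add hR.one_lt_p hR.C_pos Λ
  refine ⟨C + |c₀|, by positivity, fun t t' ht htt' ht' x hx hxr hz => ?_⟩
  refine le_of_forall_pos_le_add fun ε hε => ?_
  obtain ⟨y, hy, hyt, hyc, hyR, -⟩ := hnear t ⟨ht, htt'.trans ht'⟩ x hx hxr (min ε 1)
    (by positivity) (min_le_right _ _)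
  have hy' := hy.mono le_rfl htt' ht'
  have h1 := hz (y t') (hy.mem t' ⟨htt', ht'⟩) (hyR t' ⟨htt', ht'⟩)
  have h2 := mul_le_mul_of_nonneg_left (hy'.norm_sub_le hR.one_lt_p htt') hΛ
  have hI := hy'.intervalIntegrable_rpow hR.one_lt_p htt'
  have h3 := intervalIntegral.integral_mono_on htt'
    ((hy'.intervalIntegrable_norm hR.one_lt_p htt').const_mul Λ)
    ((hI.const_mul C₀).add (intervalIntegrable_const (c := C)))
    (fun s _ => hY _ (norm_nonneg _))
  rw [intervalIntegral.integral_const_mul,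
    intervalIntegral.integral_add (hI.const_mul C₀) intervalIntegrable_const,
    intervalIntegral.integral_const_mul, intervalIntegral.integral_const, smul_eq_mul] at h3
  have h4 := hR.le_integral hy' ht htt' ht'
  have h5 := hR.integral_add_value_le ht htt' ht' hy
  have h6 := mul_le_mul_of_nonneg_right (neg_abs_le c₀) (sub_nonneg.2 htt')
  rw [hyt] at h2
  linarith [min_le_left ε 1]

/-! ### Comparison with the value at the vertex -/

/-- Shrinking `z` by `‖z‖` lands on the vertex, so the inward bound supplies the linear growth
condition that the waiting estimate requires. -/
theorem exists_value_zero_le (hR : P.Regular C₀ c₀ G) :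
    ∃ C, 0 ≤ C ∧ ∀ t t', 0 ≤ t → t ≤ t' → t' ≤ P.T →
      P.value 0 t' ≤ P.value 0 t + C * (t' - t) := by
  obtain ⟨R', -, h⟩ := hR.exists_value_le_of_le 0
  obtain ⟨Λ, hΛ, hsh⟩ := hR.exists_value_shrink_le R'
  obtain ⟨C, hC, hC'⟩ := h Λ hΛ
  have h0 : (0 : E N) ∈ junction N := edge_subset ⟨0, hR.pos⟩ (zero_mem_edge _)
  refine ⟨C, hC, fun t t' ht htt' ht' => hC' t t' ht htt' ht' 0 h0 (by simp) fun z hz hzR => ?_⟩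
  rw [sub_zero]
  have := hsh t' ⟨ht.trans htt', ht'⟩ z hz hzR ‖z‖ (norm_nonneg _)
  rwa [shrink_norm_self hz] at this

theorem exists_value_pt_le_zero (hR : P.Regular C₀ c₀ G) {η : ℝ} (hη0 : 0 ≤ η)
    (hη : 0 < η ∨ ContinuousOn P.terminalCost (junction N)) (r : ℝ) :
    ∃ C, 0 ≤ C ∧ ∀ t ∈ Icc 0 (P.T - η), ∀ i, ∀ ρ ∈ Icc 0 r,
      P.value (pt i ρ) t ≤ P.value 0 t + C * ρ := by
  obtain ⟨K, hK⟩ := hR.bounds (|r| + 1) (by positivity)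
  obtain ⟨C₃, hC₃, h3⟩ := hR.exists_value_zero_le
  obtain ⟨V, hV⟩ := hR.exists_abs_value_le |r|
  have hK0 := hK.K_nonneg
  -- `2 * K + C₃` pays for travelling to the vertex. If time is short, then either `ρ > η` and `2 *
  -- |V| / η` covers the oscillation of the value, or the point waits until the end and an extra `K`
  -- pays for the terminal cost. For `η = 0` the quotient is zero by convention and is not used.
  refine ⟨3 * K + C₃ + 2 * |V| / η, by positivity, fun t ht i ρ hρ => ?_⟩
  have htT : t ≤ P.T := by linarith [ht.2]
  have hr : ρ ≤ |r| + 1 := by linarith [hρ.2, le_abs_self r]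
  have hVη : 0 ≤ 2 * |V| / η * ρ := mul_nonneg (by positivity) hρ.1
  have hKρ : 0 ≤ K * ρ := mul_nonneg hK0 hρ.1
  rcases le_or_gt ρ (P.T - t) with h | h
  · have h1 := hR.value_pt_le hK ht.1 (show t ≤ t + ρ by linarith [hρ.1]) (by linarith) i
      (r := ρ) (v := -1) (by simp) fun s hs => ⟨by linarith [hs.2], by linarith [hs.1]⟩
    rw [add_sub_cancel_left, neg_one_mul, add_neg_cancel, pt_zero] at h1
    have h2 := h3 t (t + ρ) ht.1 (by linarith [hρ.1]) (by linarith)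
    rw [add_sub_cancel_left] at h2
    linarith
  · rcases hη with hη | hg
    · have h1 := (abs_le.1 (hV (pt i ρ) (pt_mem i hρ.1)
        (by rw [norm_pt i hρ.1]; exact hρ.2.trans (le_abs_self r)) t ⟨ht.1, htT⟩)).2
      have h2 := (abs_le.1 (hV 0 (edge_subset i (zero_mem_edge i)) (by simp) t ⟨ht.1, htT⟩)).1
      have h4 : 2 * |V| / η * η ≤ 2 * |V| / η * ρ :=
        mul_le_mul_of_nonneg_left (by linarith [ht.2]) (by positivity)
      rw [div_mul_cancel₀ _ hη.ne'] at h4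
      have h5 : 0 ≤ C₃ * ρ := mul_nonneg hC₃ hρ.1
      linarith [le_abs_self V]
    · have h1 := hR.value_pt_le hK ht.1 htT le_rfl i (r := ρ) (v := 0) (by simp)
        fun s _ => ⟨by linarith [hρ.1], by linarith⟩
      rw [zero_mul, add_zero, hR.value_final (pt_mem i hρ.1)] at h1
      have h2 := h3 t P.T ht.1 htT le_rfl
      rw [hR.value_final (edge_subset i (zero_mem_edge i))] at h2
      have h4 : P.terminalCost (pt i ρ) ≤ P.terminalCost 0 + K * ρ := by
        rcases hρ.1.eq_or_lt with h0 | h0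
        · rw [← h0, pt_zero]; simp
        · have hne : pt i ρ ≠ 0 := by rw [← norm_pos_iff, norm_pt i hρ.1]; exact h0
          rw [terminalCost_of_mem P (pt_mem_edge i hρ.1) hne, pt_apply_self,
            ← g_zero_eq_of_continuousOn hR.standing hg i]
          have := hK.g_lip i ρ ⟨hρ.1, hr⟩ 0 ⟨le_rfl, by positivity⟩
          rw [sub_zero, abs_of_nonneg hρ.1] at this
          linarith
      have h5 := mul_le_mul_of_nonneg_left h.le hC₃
      have h6 := mul_le_mul_of_nonneg_left h.le hK0
      linarith

/-- The outward bound: follow the expanded trajectory until its exit, then estimate the effect of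
the leftover gap at the vertex or in the terminal cost. -/
theorem exists_value_pt_add_le (hR : P.Regular C₀ c₀ G) {η : ℝ} (hη0 : 0 ≤ η)
    (hη : 0 < η ∨ ContinuousOn P.terminalCost (junction N)) (r : ℝ) :
    ∃ C, 0 ≤ C ∧ ∀ t ∈ Icc 0 (P.T - η), ∀ i, ∀ ρ h : ℝ, 0 ≤ ρ → 0 ≤ h → ρ + h ≤ r →
      P.value (pt i (ρ + h)) t ≤ P.value (pt i ρ) t + C * h := by
  obtain ⟨R', A, hrR, hA0, hnear⟩ := hR.exists_near_bounded r
  -- `M` is chosen so that a gap `h ≤ η / 4` still open at `τ` forces `τ - t - h ≤ η / 2`, leaving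
  -- time `η / 4` before the horizon. With a continuous terminal cost no such reserve is needed.
  obtain ⟨η', h₀, M, hη'0, hη', hh₀, hM, hτ⟩ : ∃ η' h₀ M : ℝ, 0 ≤ η' ∧
      (0 < η' ∨ ContinuousOn P.terminalCost (junction N)) ∧ 0 < h₀ ∧ 0 < M ∧
      ∀ t ∈ Icc 0 (P.T - η), ∀ τ ∈ Icc t P.T, ∀ h ≤ h₀, M ^ P.p * (τ - t - h) ≤ A →
        τ ≤ P.T - η' := by
    rcases hη with hη | hg
    · obtain ⟨M, hM, hM'⟩ := exists_le_mul_rpow hR.one_lt_p (half_pos hη) A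
      refine ⟨η / 4, η / 4, M, by positivity, Or.inl (by positivity), by positivity, hM,
        fun t ht τ hτ h hh hA => ?_⟩
      have hMp : 0 < M ^ P.p := Real.rpow_pos_of_pos hM _
      have h1 : M ^ P.p * (τ - t - h) ≤ M ^ P.p * (η / 2) := by linarith
      have h2 := le_of_mul_le_mul_left h1 hMp
      linarith [ht.2]
    · exact ⟨0, 1, 1, le_rfl, Or.inr hg, one_pos, one_pos, fun t _ τ hτ _ _ _ => by
        linarith [hτ.2]⟩
  obtain ⟨K, hK⟩ := hR.bounds (|R'| + |r| + 1) (by positivity)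
  obtain ⟨C₁, hC₁, h1⟩ := hR.exists_value_pt_le_zero hη'0 hη' r
  obtain ⟨V, hV⟩ := hR.exists_abs_value_le |r|
  have hS := hK.slowCost_nonneg hM.le
  have hK0 := hK.K_nonneg
  have hT := hR.standing.T_pos
  set S := P.slowCost c₀ K M + K * (A + P.T) with hSdef
  have hS0 : 0 ≤ S := by positivity
  refine ⟨S + C₁ + K + 2 * |V| / h₀, by positivity, fun t ht i ρ h hρ hh hρh => ?_⟩
  have htT : t ∈ Icc 0 P.T := ⟨ht.1, by linarith [ht.2]⟩
  have hVh : 0 ≤ 2 * |V| / h₀ * h := mul_nonneg (by positivity) hh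
  have hSh : 0 ≤ S * h := mul_nonneg hS0 hh
  have hC₁h : 0 ≤ C₁ * h := mul_nonneg hC₁ hh
  have hKh : 0 ≤ K * h := mul_nonneg hK0 hh
  rcases le_or_gt h h₀ with hle | hgt
  · refine le_of_forall_pos_le_add fun ε hε => ?_
    obtain ⟨y, hy, hyt, hyc, hyR, hyA⟩ := hnear t htT (pt i ρ) (pt_mem i hρ)
      (by rw [norm_pt i hρ]; linarith) (min ε 1) (by positivity) (min_le_right _ _)
    obtain ⟨τ, hτI, σ, hσ, hyτ, hval, hexit, htime⟩ := hR.exists_expand hK hM htT hy hρ hyt hh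
      (fun s hs => by linarith [hyR s hs, le_abs_self R', le_abs_self r]) hyA
    have h2 := hR.integral_add_value_le ht.1 hτI.1 hτI.2 hy
    have h3 : P.value (y τ + pt i σ) τ ≤ P.value (y τ) τ + (C₁ + K) * σ := by
      rcases hσ.1.eq_or_lt with h0 | h0
      · rw [← h0, pt_zero]; simp
      have hC₁σ := mul_nonneg hC₁ hσ.1
      have hKσ := mul_nonneg hK0 hσ.1
      -- With a gap still open, the exit is either at the vertex, where the comparison with the
      -- vertex value applies, or at the final time inside the edge, where `g_i` is Lipschitz.
      by_cases hy0 : y τ = 0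
      · have h4 : τ ≤ P.T - η' := hτ t ht τ hτI h hle (htime.resolve_left h0.ne')
        have h5 := h1 τ ⟨ht.1.trans hτI.1, h4⟩ i σ ⟨hσ.1, by linarith [hσ.2]⟩
        rw [hy0, zero_add]
        linarith
      · obtain rfl := (hexit.resolve_left h0.ne').resolve_left hy0
        have hpos := pos_of_mem_edge hyτ hy0
        have e : y P.T + pt i σ = pt i (y P.T i + σ) := by
          conv_lhs => rw [eq_pt_of_mem_edge hyτ]
          rw [pt_add]
        have hmem : pt i (y P.T i + σ) ∈ edge i := pt_mem_edge i (by linarith)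
        have hne : pt i (y P.T i + σ) ≠ 0 := by
          rw [← norm_pos_iff, norm_pt i (by linarith)]; linarith
        have hb := hyR P.T ⟨htT.2, le_rfl⟩
        rw [norm_of_mem_edge hyτ] at hb
        have hRσ : y P.T i + σ ≤ |R'| + |r| + 1 := by
          linarith [hσ.2, le_abs_self R', le_abs_self r]
        rw [e, hR.value_final (edge_subset i hmem), hR.value_final (edge_subset i hyτ),
          terminalCost_of_mem P hmem hne, terminalCost_of_mem P hyτ hy0, pt_apply_self]
        have h5 := hK.g_lip i (y P.T i + σ) ⟨by linarith, hRσ⟩ (y P.T i) ⟨hpos.le, by linarith⟩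
        rw [add_sub_cancel_left, abs_of_pos h0] at h5
        linarith
    have h4 : (C₁ + K) * σ ≤ (C₁ + K) * h := mul_le_mul_of_nonneg_left hσ.2 (by positivity)
    linarith [min_le_left ε 1]
  · have h2 := (abs_le.1 (hV (pt i (ρ + h)) (pt_mem i (by linarith))
      (by rw [norm_pt i (by linarith)]; linarith [le_abs_self r]) t htT)).2
    have h3 := (abs_le.1 (hV (pt i ρ) (pt_mem i hρ)
      (by rw [norm_pt i hρ]; linarith [le_abs_self r]) t htT)).1
    have h4 : 2 * |V| / h₀ * h₀ ≤ 2 * |V| / h₀ * h :=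
      mul_le_mul_of_nonneg_left hgt.le (by positivity)
    rw [div_mul_cancel₀ _ hh₀.ne'] at h4
    linarith [le_abs_self V]

/-! ### Lipschitz bounds in space and time -/

/-- On a common edge the inward or the outward bound applies, according to which point is closer to
the vertex. On different edges both are used through the vertex, which matches the geodesic
distance. -/
theorem exists_value_le_add_geoDist (hR : P.Regular C₀ c₀ G) {η : ℝ} (hη0 : 0 ≤ η)
    (hη : 0 < η ∨ ContinuousOn P.terminalCost (junction N)) (r : ℝ) :
    ∃ C, 0 ≤ C ∧ ∀ t ∈ Icc 0 (P.T - η), ∀ x₁ ∈ junction N, ∀ x₂ ∈ junction N, ‖x₁‖ ≤ r →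
      ‖x₂‖ ≤ r → P.value x₁ t ≤ P.value x₂ t + C * geoDist x₁ x₂ := by
  obtain ⟨C₁, hC₁, h1⟩ := hR.exists_value_shrink_le r
  obtain ⟨C₂, hC₂, h2⟩ := hR.exists_value_pt_add_le hη0 hη r
  refine ⟨C₁ + C₂, by positivity, fun t ht x₁ hx₁ x₂ hx₂ hr₁ hr₂ => ?_⟩
  have htT : t ∈ Icc 0 P.T := ⟨ht.1, by linarith [ht.2]⟩
  by_cases hc : ∃ i, x₁ ∈ edge i ∧ x₂ ∈ edge i
  · obtain ⟨i, hi₁, hi₂⟩ := hc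
    have p₁ := (mem_edge_iff.1 hi₁).1
    have p₂ := (mem_edge_iff.1 hi₂).1
    rw [norm_of_mem_edge hi₁] at hr₁
    rw [eq_pt_of_mem_edge hi₁, eq_pt_of_mem_edge hi₂, geoDist_pt i p₁ p₂]
    have e₁ : 0 ≤ C₁ * |x₁ i - x₂ i| := by positivity
    have e₂ : 0 ≤ C₂ * |x₁ i - x₂ i| := by positivity
    rcases le_total (x₁ i) (x₂ i) with h | h
    · have h3 := h1 t htT (pt i (x₂ i)) (pt_mem i p₂) (by rwa [← eq_pt_of_mem_edge hi₂])
        (x₂ i - x₁ i) (by linarith)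
      rw [shrink_pt i (by linarith), sub_sub_cancel, max_eq_left p₁, ← abs_of_nonneg
        (sub_nonneg.2 h), abs_sub_comm] at h3
      linarith
    · have h3 := h2 t ht i (x₂ i) (x₁ i - x₂ i) p₂ (by linarith) (by linarith)
      rw [add_sub_cancel, ← abs_of_nonneg (sub_nonneg.2 h)] at h3
      linarith
  · rw [geoDist_of_not hc]
    obtain ⟨i, hi₁⟩ := mem_junction_iff.1 hx₁
    have p₁ := (mem_edge_iff.1 hi₁).1
    have h3 := h2 t ht i 0 (x₁ i) le_rfl p₁ (by rwa [zero_add, ← norm_of_mem_edge hi₁])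
    rw [zero_add, pt_zero, ← eq_pt_of_mem_edge hi₁, ← norm_of_mem_edge hi₁] at h3
    have h4 := h1 t htT x₂ hx₂ hr₂ ‖x₂‖ (norm_nonneg _)
    rw [shrink_norm_self hx₂] at h4
    have e₁ : 0 ≤ C₁ * ‖x₁‖ := by positivity
    have e₂ : 0 ≤ C₂ * ‖x₂‖ := by positivity
    linarith

theorem exists_value_lipschitz (hR : P.Regular C₀ c₀ G) {η : ℝ} (hη0 : 0 ≤ η)
    (hη : 0 < η ∨ ContinuousOn P.terminalCost (junction N)) (r : ℝ) :
    ∃ C, ∀ x₁ ∈ junction N, ∀ x₂ ∈ junction N, ‖x₁‖ ≤ r → ‖x₂‖ ≤ r →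
      ∀ t₁ ∈ Icc 0 (P.T - η), ∀ t₂ ∈ Icc 0 (P.T - η),
        |P.value x₁ t₁ - P.value x₂ t₂| ≤ C * (geoDist x₁ x₂ + |t₁ - t₂|) := by
  obtain ⟨R', hrR, hstep⟩ := hR.exists_value_le_of_le r
  -- The spatial bound is needed on the larger ball `R'` that contains the near-optimal
  -- trajectories. The factor 2 in the next slope converts geodesic distance to norm.
  obtain ⟨C₁, hC₁, h1⟩ := hR.exists_value_le_add_geoDist hη0 hη R'
  obtain ⟨C₂, hC₂, h2⟩ := hstep (C₁ * 2) (by positivity)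
  obtain ⟨K, hK⟩ := hR.bounds (|r| + 1) (by positivity)
  have hK0 := hK.K_nonneg
  have hfwd : ∀ x ∈ junction N, ‖x‖ ≤ r → ∀ t t', 0 ≤ t → t ≤ t' → t' ≤ P.T - η →
      |P.value x t - P.value x t'| ≤ (C₂ + 2 * K) * (t' - t) := by
    intro x hx hxr t t' ht htt' ht'
    have h3 := h2 t t' ht htt' (by linarith) x hx hxr fun z hz hzR => by
      have h := h1 t' ⟨ht.trans htt', ht'⟩ x hx z hz (hxr.trans hrR) hzR
      have h' := mul_le_mul_of_nonneg_left (geoDist_le_two_mul hx hz) hC₁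
      rw [norm_sub_rev] at h'
      linarith
    obtain ⟨i, hi⟩ := mem_junction_iff.1 hx
    have h4 := hR.value_pt_le hK ht htt' (by linarith) i (r := x i) (v := 0) (by simp) fun s _ => by
      rw [zero_mul, add_zero, ← norm_of_mem_edge hi]
      exact ⟨norm_nonneg _, by linarith [le_abs_self r]⟩
    rw [zero_mul, add_zero, ← eq_pt_of_mem_edge hi] at h4
    have h5 := mul_nonneg hC₂ (sub_nonneg.2 htt')
    have h6 := mul_nonneg hK0 (sub_nonneg.2 htt')
    rw [abs_le]
    constructor <;> linarith
  have htime : ∀ x ∈ junction N, ‖x‖ ≤ r → ∀ t₁ ∈ Icc 0 (P.T - η), ∀ t₂ ∈ Icc 0 (P.T - η),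
      |P.value x t₁ - P.value x t₂| ≤ (C₂ + 2 * K) * |t₁ - t₂| := by
    intro x hx hxr t₁ ht₁ t₂ ht₂
    rcases le_total t₁ t₂ with h | h
    · rw [abs_sub_comm t₁, abs_of_nonneg (sub_nonneg.2 h)]
      exact hfwd x hx hxr t₁ t₂ ht₁.1 h ht₂.2
    · rw [abs_sub_comm (P.value x t₁), abs_of_nonneg (sub_nonneg.2 h)]
      exact hfwd x hx hxr t₂ t₁ ht₂.1 h ht₁.2
  refine ⟨C₁ + C₂ + 2 * K, fun x₁ hx₁ x₂ hx₂ hr₁ hr₂ t₁ ht₁ t₂ ht₂ => ?_⟩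
  have hg0 : 0 ≤ geoDist x₁ x₂ := (norm_nonneg _).trans (norm_sub_le_geoDist _ _)
  have hsp : |P.value x₁ t₁ - P.value x₂ t₁| ≤ C₁ * geoDist x₁ x₂ := by
    have ha := h1 t₁ ht₁ x₁ hx₁ x₂ hx₂ (hr₁.trans hrR) (hr₂.trans hrR)
    have hb := h1 t₁ ht₁ x₂ hx₂ x₁ hx₁ (hr₂.trans hrR) (hr₁.trans hrR)
    rw [geoDist_comm] at hb
    rw [abs_le]
    constructor <;> linarith
  have htm := htime x₂ hx₂ hr₂ t₁ ht₁ t₂ ht₂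
  have htri := abs_sub_le (P.value x₁ t₁) (P.value x₂ t₁) (P.value x₂ t₂)
  have e₁ : 0 ≤ C₁ * |t₁ - t₂| := by positivity
  have e₂ : 0 ≤ (C₂ + 2 * K) * geoDist x₁ x₂ := by positivity
  linarith

theorem locLip (hR : P.Regular C₀ c₀ G) {S : Set ℝ}
    (hS : ∀ t ∈ S, ∃ η δ : ℝ, 0 ≤ η ∧ (0 < η ∨ ContinuousOn P.terminalCost (junction N)) ∧
      0 < δ ∧ ∀ t' ∈ S, |t - t'| < δ → t' ∈ Icc 0 (P.T - η)) : LocLip P.value S := by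
  intro x _ t ht
  obtain ⟨η, δ, hη0, hη, hδ, hmem⟩ := hS t ht
  obtain ⟨C, hC⟩ := hR.exists_value_lipschitz hη0 hη (‖x‖ + δ)
  have hn : ∀ x' : E N, geoDist x x' < δ → ‖x'‖ ≤ ‖x‖ + δ := fun x' h => by
    have h1 := norm_sub_le_geoDist x x'
    have h2 : ‖x'‖ ≤ ‖x‖ + ‖x - x'‖ := by
      simpa using norm_sub_le x (x - x')
    linarith
  exact ⟨C, δ, hδ, fun x₁ hx₁ x₂ hx₂ t₁ ht₁ t₂ ht₂ d₁ d₂ e₁ e₂ =>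
    hC x₁ hx₁ x₂ hx₂ (hn x₁ d₁) (hn x₂ d₂) t₁ (hmem t₁ ht₁ e₁) t₂ (hmem t₂ ht₂ e₂)⟩

end Regular

end Problem

end JunctionControl

end

/-- The first conjunct says that the value function is a genuine infimum of well-defined costs. -/
theorem mainTheorem7 {N : ℕ} (hN : 1 < N) (P : JunctionControl.Problem N) (hP : P.Standing)
    (h1 : P.H1) (h2 : P.H2) (h3 : P.H3) (h4 : P.H4) (h5 : P.H5) :
    (∀ x ∈ JunctionControl.junction N, ∀ t ∈ Set.Icc 0 P.T,
      (∀ y, P.Admissible t x y →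
        IntervalIntegrable (fun s => P.runningCost (y s) (deriv y s) s)
          MeasureTheory.volume t P.T) ∧
      IsGLB (P.cost t '' {y | P.Admissible t x y}) (P.value x t)) ∧
    JunctionControl.LocLip P.value (Set.Ico 0 P.T) ∧
    (ContinuousOn P.terminalCost (JunctionControl.junction N) →
      JunctionControl.LocLip P.value (Set.Icc 0 P.T)) := by
  obtain ⟨C₀, c₀, hb⟩ := JunctionControl.Problem.exists_bounds (by omega) hP h1 h3 h5
  obtain ⟨G, hG⟩ := JunctionControl.Problem.exists_abs_terminalCost_le hP
  have hR : P.Regular C₀ c₀ G := ⟨hP, by omega, hb, hG⟩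
  refine ⟨fun x hx t ht => ⟨fun y hy => ?_, ?_⟩, hR.locLip fun t ht => ?_,
    fun hg => hR.locLip fun t _ => ⟨0, 1, le_rfl, Or.inr hg, one_pos, fun t' ht' _ => by
      simpa using ht'⟩⟩
  · exact hR.integrable (JunctionControl.Problem.admissible_iff.1 hy).1 ht.1 ht.2 le_rfl
  · obtain ⟨y, hy, hyt, -⟩ := hR.exists_near ht hx one_pos
    exact isGLB_csInf ⟨_, y, JunctionControl.Problem.admissible_iff.2 ⟨hy, hyt⟩, rfl⟩
      (hR.bddBelow ht x)
  -- With `η = δ = (P.T - t) / 2`, every `t'` within `δ` of `t` satisfies `t' ≤ P.T - η`.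
  · refine ⟨(P.T - t) / 2, (P.T - t) / 2, by linarith [ht.2], Or.inl (by linarith [ht.2]),
      by linarith [ht.2], fun t' ht' h => ⟨ht'.1, ?_⟩⟩
    linarith [(abs_lt.1 h).1]
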